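/- Let $\mathbb H$ be the quaternions, $\mathbb B=\{q\in\mathbb H:|q|<1\}$, and $\mathbb S^2=\{i\in\mathbb H:\operatorname{Re} i=0,\ |i|=1\}$. For $i\in\mathbb S^2$ put $\mathbb C(i)=\{x+yi:x,y\in\mathbb R\}$ and $\mathbb B_i=\mathbb B\cap\mathbb C(i)$, and let $d\lambda_i(z)=\frac{dA_i(z)}{(1-|z|^2)^2}$ on $\mathbb B_i$, where $dA_i=\frac1\pi\,dx\,dy$ is the normalized area measure in the coordinates $z=x+yi$. A function $f:\mathbb B\to\mathbb H$ is slice regular if it is real differentiable and $\left(\frac{\partial}{\partial x}+i\frac{\partial}{\partial y}\right)f(x+yi)=0$ on $\mathbb B_i$ for every $i\in\mathbb S^2$. Write $\partial_{x_0}$ for the partial derivative with respect to the real part of the variable. Fix an integer $n\ge 2$. The slice regular Besov space $\mathfrak B_1$ is the set of all slice regular $f$ on $\mathbb B$ with $$\sup_{j\in\mathbb S^2}\int_{\mathbb B_j}\left|(1-|z|^2)^n\,\partial_{x_0}^n f(z)\right|\,d\lambda_j(z)<\infty .$$ For $a\in\mathbb B$ let $T_a(q)=(1-q\bar a)^{-\ast}\ast(a-q)$,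 $q\in\mathbb B$, be the slice regular Möbius transformation, where $\ast$ is the slice regular product $\left(\sum_n q^na_n\right)\ast\left(\sum_n q^nb_n\right)=\sum_n q^n\sum_{k=0}^n a_kb_{n-k}$ and $^{-\ast}$ is the inverse for it. **Proposition.** Let $f$ be slice regular on $\mathbb B$ and let $i\in\mathbb S^2$. The following are equivalent (for every choice of $n\ge2$ in the definition of $\mathfrak B_1$): (i) $f\in\mathfrak B_1$. (ii) There are a sequence $(\gamma_k)_{k\ge0}\in\ell^1(\mathbb H)$ and a sequence $(a_k)_{k\ge1}$ in $\mathbb B_i$ such that $f(q)=\gamma_0+\sum_{k=1}^\infty T_{a_k}(q)\gamma_k$ for all $q\in\mathbb B$. (iii) There is a finite $\mathbb H$-valued Borel measure $\mu$ on $\mathbb B_i$ (a countably additive $\mathbb H$-valued set function of finite total variation) such that $f(q)=\int_{\mathbb B_i}T_z(q)\,d\mu(z)$ for all $q\in\mathbb B$. -/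

import Mathlib

open scoped Quaternion

noncomputable section

namespace SliceBesov

/-- The Borel `σ`-algebra on the quaternions. -/
instance instMeasurableSpaceQuaternion : MeasurableSpace ℍ[ℝ] := borel ℍ[ℝ]

instance instBorelSpaceQuaternion : BorelSpace ℍ[ℝ] := ⟨rfl⟩

/-- The sphere `𝕊²` of purely imaginary unit quaternions. -/
def imagSphere : Set ℍ[ℝ] := {i | i.re = 0 ∧ ‖i‖ = 1}

/-- The open unit ball `𝔹` of the quaternions. -/
def unitBall : Set ℍ[ℝ] := Metric.ball 0 1

/-- The parametrization `x + y√-1 ↦ x + y i` of the plane `ℂ(i)`; for `i ∈ 𝕊²` it is isometric. -/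
def sliceMap (i : ℍ[ℝ]) (z : ℂ) : ℍ[ℝ] := (z.re : ℍ[ℝ]) + (z.im : ℍ[ℝ]) * i

/-- The plane `ℂ(i) = {x + y i : x, y ∈ ℝ}`. -/
def slicePlane (i : ℍ[ℝ]) : Set ℍ[ℝ] := Set.range (sliceMap i)

/-- The unit disc `𝔹_i = 𝔹 ∩ ℂ(i)` of the plane `ℂ(i)`. -/
def sliceDisc (i : ℍ[ℝ]) : Set ℍ[ℝ] := unitBall ∩ slicePlane i

/-- (Left) slice regular functions on `Ω`: real differentiable functions with
`(∂/∂x + i ∂/∂y) f (x + y i) = 0` on `Ω ∩ ℂ(i)` for every `i ∈ 𝕊²`. -/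
def SliceRegularOn (f : ℍ[ℝ] → ℍ[ℝ]) (Ω : Set ℍ[ℝ]) : Prop :=
  DifferentiableOn ℝ f Ω ∧
    ∀ i ∈ imagSphere, ∀ q ∈ Ω ∩ slicePlane i, fderiv ℝ f q 1 + i * fderiv ℝ f q i = 0

/-- The `n`-th partial derivative of `f` with respect to the real coordinate `x₀`. -/
def realPartialDeriv (n : ℕ) (f : ℍ[ℝ] → ℍ[ℝ]) (q : ℍ[ℝ]) : ℍ[ℝ] :=
  iteratedDeriv n (fun t : ℝ => f (q + (t : ℍ[ℝ]))) 0

/-- The measure `dλ(z) = dA(z) / (1 - |z|²)²` on the unit disc, where `dA = dx dy / π`. Through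
`sliceMap i` it is the measure `λ_i` on `𝔹_i`. -/
def discMeasure : MeasureTheory.Measure ℂ :=
  (MeasureTheory.volume.restrict (Metric.ball (0 : ℂ) 1)).withDensity
    fun z => ENNReal.ofReal (1 / (Real.pi * (1 - ‖z‖ ^ 2) ^ 2))

/-- `∫_{𝔹_i} |(1 - |z|²)ⁿ ∂ⁿf/∂x₀ⁿ (z)|ᵖ dλ_i(z)`, as an extended nonnegative number. -/
def besovIntegral (p : ℝ) (n : ℕ) (f : ℍ[ℝ] → ℍ[ℝ]) (i : ℍ[ℝ]) : ENNReal :=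
  ∫⁻ z, ‖((1 - ‖z‖ ^ 2) ^ n : ℝ) • realPartialDeriv n f (sliceMap i z)‖ₑ ^ p ∂discMeasure

/-- Membership in the slice regular Besov space `B_p`, the space being defined by means of the
derivative of order `n` (where `n p > 1`). -/
def MemBesov (p : ℝ) (n : ℕ) (f : ℍ[ℝ] → ℍ[ℝ]) : Prop :=
  SliceRegularOn f unitBall ∧ (⨆ i ∈ imagSphere, besovIntegral p n f i) < ⊤

/-- The sum `∑ qⁿ cₙ` of a power series with right coefficients. The product of `PowerSeries ℍ`,
`(∑ qⁿ aₙ) * (∑ qⁿ bₙ) = ∑ qⁿ (∑ₖ aₖ bₙ₋ₖ)`, is the slice regular product. -/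
def seriesSum (φ : PowerSeries ℍ[ℝ]) (q : ℍ[ℝ]) : ℍ[ℝ] :=
  ∑' n : ℕ, q ^ n * PowerSeries.coeff n φ

/-- The slice regular Möbius transformation `T_a(q) = (1 - q ā)^{-∗} ∗ (a - q)`; the inverse and the
product are those of power series, that is the slice regular ones. -/
def moebius (a q : ℍ[ℝ]) : ℍ[ℝ] :=
  seriesSum
    (PowerSeries.invOfUnit (1 - PowerSeries.X * PowerSeries.C (star a)) 1 *
      (PowerSeries.C a - PowerSeries.X)) q

end SliceBesov

end

/-! On every slice a slice regular `f` is a power series `∑ zᵐ cₘ` with right coefficients, and the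
`cₘ` are the same for all slices. For `a` in `𝔹_i` the coefficients of `T_a` are `τ₀(a) = a` and
`τₘ₊₁(a) = āᵐ(|a|² - 1)`, again in `ℂ(i)` (`moebius_eq`). So (ii) and (iii) are moment problems:
`cₘ` is to be a sum, or an integral, of `τₘ(a)` against an `ℍ`-valued mass, up to a constant that
changes only `c₀`. By the representation formula a function is controlled on every slice by its
values on one slice, so (i) says that the `n`-th derivative of `f` has finite weighted `L¹` norm on
the slice `ℂ(i)` alone (`memBesov_one_iff`).

(ii), (iii) ⇒ (i). The `n`-th derivative of `T_a` is at most `n! (1 - |a|²) / |1 - zā|ⁿ⁺¹`. Its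
weighted `L¹` norm is bounded uniformly in `a` (`besovWeight_mul_kernel_le`,
`lintegral_one_sub_norm_div_cube_le`), and Tonelli's theorem against the finite total variation
concludes (`memBesov_one_of_eq_integral`).

(i) ⇒ (iii). A reproducing formula (`exists_integral_moebCoeff_eq`) gives `g ∈ L¹` of the disc with
`∫ τₘ g = cₘ` for all `m`. Its main part is the weight times `(z/|z|)²ⁿ⁻²` times the `n`-th
derivative with its first `n - 1` terms removed and divided by `zⁿ⁻¹`. Rotation invariance isolates
one coefficient in each pairing, and a Beta integral cancels the factorials exactly. The finitely
many indices missed are corrected by a biorthogonal system. The measure is the image of `g dA`.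

(i) ⇒ (ii). The disc is cut into countably many cells on which `a ↦ T_a` is almost constant, and the
mass of `g` on each cell is concentrated at one point. The coefficients of the error decay enough to
be represented by a new `g'` with at most half the `L¹` norm (`exists_atomic_approximation`).
Iterating leaves no error and costs a geometric series of `ℓ¹` norms. -/

noncomputable section

namespace SliceBesov

open Filter Topology MeasureTheory

/-! ### The planes `ℂ(i)` as isometric copies of the complex field -/

section SliceMap

variable {i : ℍ[ℝ]}

theorem imagSphere_mul_self (hi : i ∈ imagSphere) : i * i = -1 := by
  obtain ⟨h0, h1⟩ := hi
  have hs : star i = -i := by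
    ext <;> simp [h0]
  have := Quaternion.self_mul_star i
  rw [hs, Quaternion.normSq_eq_norm_mul_self, h1] at this
  simp only [mul_neg, mul_one, Quaternion.coe_one] at this
  rw [← this, neg_neg]

theorem imagSphere_star (hi : i ∈ imagSphere) : star i = -i := by
  ext <;> simp [hi.1]

theorem sliceMap_add (i : ℍ[ℝ]) (z w : ℂ) : sliceMap i (z + w) = sliceMap i z + sliceMap i w := by
  simp only [sliceMap, Complex.add_re, Complex.add_im, Quaternion.coe_add, add_mul]
  abel

theorem sliceMap_smul (i : ℍ[ℝ]) (r : ℝ) (z : ℂ) : sliceMap i (r • z) = r • sliceMap i z := by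
  simp [sliceMap, Quaternion.coe_mul, mul_assoc, ← Quaternion.coe_mul_eq_smul]

@[simp] theorem sliceMap_ofReal (i : ℍ[ℝ]) (r : ℝ) : sliceMap i (r : ℂ) = (r : ℍ[ℝ]) := by
  simp [sliceMap]

@[simp] theorem sliceMap_one (i : ℍ[ℝ]) : sliceMap i 1 = 1 := by
  simp [sliceMap]

@[simp] theorem sliceMap_zero (i : ℍ[ℝ]) : sliceMap i 0 = 0 := by
  simp [sliceMap]

/-- `sliceMap i` as a continuous real linear map. -/
def sliceCLM (i : ℍ[ℝ]) : ℂ →L[ℝ] ℍ[ℝ] :=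
  LinearMap.toContinuousLinearMap
    { toFun := sliceMap i
      map_add' := sliceMap_add i
      map_smul' := sliceMap_smul i }

@[simp] theorem sliceCLM_apply (i : ℍ[ℝ]) (z : ℂ) : sliceCLM i z = sliceMap i z := rfl

theorem continuous_sliceMap (i : ℍ[ℝ]) : Continuous (sliceMap i) := (sliceCLM i).continuous

theorem sliceMap_sub (i : ℍ[ℝ]) (z w : ℂ) : sliceMap i (z - w) = sliceMap i z - sliceMap i w :=
  map_sub (sliceCLM i) z w

theorem sliceMap_mul (hi : i ∈ imagSphere) (z w : ℂ) :
    sliceMap i (z * w) = sliceMap i z * sliceMap i w := by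
  have h := imagSphere_mul_self hi
  have hc : ∀ (r : ℝ) (q : ℍ[ℝ]), q * (r : ℍ[ℝ]) = r * q := fun r q =>
    (Quaternion.coe_commutes r q).symm
  have e : (z.im : ℍ[ℝ]) * i * ((w.im : ℍ[ℝ]) * i) = -((z.im * w.im : ℝ) : ℍ[ℝ]) := by
    rw [mul_assoc, ← mul_assoc i, hc w.im i, mul_assoc _ i, h]
    simp [Quaternion.coe_mul]
  simp only [sliceMap, add_mul, mul_add, Complex.mul_re, Complex.mul_im, e, Quaternion.coe_sub,
    Quaternion.coe_add, Quaternion.coe_mul]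
  have e2 : (z.im : ℍ[ℝ]) * i * (w.re : ℍ[ℝ]) = z.im * w.re * i := by
    rw [mul_assoc, hc w.re i, mul_assoc]
  rw [e2, ← mul_assoc]
  abel

theorem sliceMap_pow (hi : i ∈ imagSphere) (z : ℂ) (n : ℕ) :
    sliceMap i (z ^ n) = sliceMap i z ^ n := by
  induction n with
  | zero => simp
  | succ n ih => rw [pow_succ, pow_succ, sliceMap_mul hi, ih]

theorem sliceMap_star (hi : i ∈ imagSphere) (z : ℂ) :
    star (sliceMap i z) = sliceMap i (starRingEnd ℂ z) := by
  simp only [sliceMap, star_add, star_mul, Quaternion.star_coe, imagSphere_star hi,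
    Complex.conj_re, Complex.conj_im, Quaternion.coe_neg, neg_mul]
  rw [Quaternion.coe_commutes]

theorem norm_sliceMap (hi : i ∈ imagSphere) (z : ℂ) : ‖sliceMap i z‖ = ‖z‖ := by
  have h : ‖sliceMap i z‖ * ‖sliceMap i z‖ = ‖z‖ * ‖z‖ := by
    rw [← Quaternion.normSq_eq_norm_mul_self, ← Complex.normSq_eq_norm_sq z |>.trans (sq _)]
    have := Quaternion.self_mul_star (sliceMap i z)
    rw [sliceMap_star hi, ← sliceMap_mul hi, Complex.mul_conj, sliceMap_ofReal] at this
    exact (Quaternion.coe_injective this).symm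
  exact (mul_self_inj (norm_nonneg _) (norm_nonneg _)).1 h

theorem mem_unitBall {q : ℍ[ℝ]} : q ∈ unitBall ↔ ‖q‖ < 1 := by
  simp [unitBall]

theorem sliceMap_mem_unitBall (hi : i ∈ imagSphere) {z : ℂ} : sliceMap i z ∈ unitBall ↔ ‖z‖ < 1 := by
  rw [mem_unitBall, norm_sliceMap hi]

theorem mem_sliceDisc (hi : i ∈ imagSphere) {q : ℍ[ℝ]} :
    q ∈ sliceDisc i ↔ ∃ z : ℂ, ‖z‖ < 1 ∧ sliceMap i z = q := by
  constructor
  · rintro ⟨h, z, rfl⟩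
    exact ⟨z, (sliceMap_mem_unitBall hi).1 h, rfl⟩
  · rintro ⟨z, h, rfl⟩
    exact ⟨(sliceMap_mem_unitBall hi).2 h, z, rfl⟩

theorem imagSphere_nonempty : imagSphere.Nonempty := by
  let i : ℍ[ℝ] := ⟨0, 1, 0, 0⟩
  refine ⟨i, rfl, ?_⟩
  have : ‖i‖ * ‖i‖ = 1 := by
    rw [← Quaternion.normSq_eq_norm_mul_self, Quaternion.normSq_def']; simp [i]
  nlinarith [norm_nonneg i]

theorem exists_sliceMap_eq (q : ℍ[ℝ]) : ∃ i ∈ imagSphere, ∃ z : ℂ, sliceMap i z = q := by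
  by_cases h : q.im = 0
  · obtain ⟨i, hi⟩ := imagSphere_nonempty
    refine ⟨i, hi, (q.re : ℂ), ?_⟩
    rw [sliceMap_ofReal, ← Quaternion.re_add_im q, h]
    simp
  · refine ⟨(‖q.im‖⁻¹ : ℝ) • q.im, ⟨by simp, ?_⟩, ⟨q.re, ‖q.im‖⟩, ?_⟩
    · rw [norm_smul, norm_inv, norm_norm, inv_mul_cancel₀ (norm_ne_zero_iff.2 h)]
    · simp only [sliceMap]
      rw [Quaternion.coe_mul_eq_smul, smul_smul, mul_inv_cancel₀ (norm_ne_zero_iff.2 h), one_smul,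
        Quaternion.re_add_im]

end SliceMap

/-! ### Coefficient sequences of power series converging on the unit disc -/

section Coefficients

/-- The power series with coefficients `c` converges absolutely on the open unit disc. -/
def HasRadiusOne {E : Type*} [Norm E] (c : ℕ → E) : Prop :=
  ∀ r : ℝ, 0 ≤ r → r < 1 → Summable fun m => ‖c m‖ * r ^ m

/-- The coefficients of the `n`-th derivative of a power series. -/
def derivCoeff {E : Type*} [SMul ℝ E] (n : ℕ) (c : ℕ → E) (k : ℕ) : E :=
  ((k + n).descFactorial n : ℝ) • c (k + n)

theorem exists_pow_mul_geometric_le (p : ℕ) {x : ℝ} (hx0 : 0 ≤ x) (hx : x < 1) :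
    ∃ C : ℝ, 0 ≤ C ∧ ∀ m : ℕ, ((m : ℝ) + 1) ^ p * x ^ m ≤ C := by
  have h1 : Summable fun m : ℕ => ((m : ℝ) + 1) ^ p * x ^ m := by
    have : ∀ m : ℕ, ((m : ℝ) + 1) ^ p * x ^ m
        = ∑ j ∈ Finset.range (p + 1), (p.choose j : ℝ) * ((m : ℝ) ^ j * x ^ m) := by
      intro m
      rw [add_pow, Finset.sum_mul]
      refine Finset.sum_congr rfl fun j _ => ?_
      simp; ring
    simp_rw [this]
    refine summable_sum fun j _ => Summable.mul_left _ ?_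
    exact summable_pow_mul_geometric_of_norm_lt_one j (by rwa [Real.norm_of_nonneg hx0])
  refine ⟨∑' m : ℕ, ((m : ℝ) + 1) ^ p * x ^ m, tsum_nonneg fun m => by positivity, fun m => ?_⟩
  exact h1.le_tsum m fun j _ => by positivity

variable {E : Type*} [NormedAddCommGroup E] {c : ℕ → E}

theorem HasRadiusOne.of_bounded (h : ∀ r : ℝ, 0 < r → r < 1 → ∃ M, ∀ m, ‖c m‖ * r ^ m ≤ M) :
    HasRadiusOne c := by
  intro r hr0 hr
  obtain ⟨ρ, h1, h2⟩ := exists_between hr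
  have hρ : 0 < ρ := hr0.trans_lt h1
  obtain ⟨M, hM⟩ := h ρ hρ h2
  have hx : r / ρ < 1 := (div_lt_one hρ).2 h1
  refine Summable.of_nonneg_of_le (fun m => by positivity) (fun m => ?_)
    ((summable_geometric_of_lt_one (by positivity) hx).mul_left M)
  calc ‖c m‖ * r ^ m = ‖c m‖ * ρ ^ m * (r / ρ) ^ m := by
        rw [div_pow, mul_assoc, mul_div_cancel₀ _ (by positivity)]
    _ ≤ M * (r / ρ) ^ m := by gcongr; exact hM m

theorem HasRadiusOne.of_norm_le {M : ℝ} (h : ∀ m, ‖c m‖ ≤ M) : HasRadiusOne c :=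
  HasRadiusOne.of_bounded fun _ hr0 hr => ⟨M, fun m =>
    (mul_le_of_le_one_right (norm_nonneg _) (pow_le_one₀ hr0.le hr.le)).trans (h m)⟩

theorem HasRadiusOne.mono {F : Type*} [NormedAddCommGroup F] {d : ℕ → F} (hc : HasRadiusOne c)
    (h : ∀ m, ‖d m‖ ≤ ‖c m‖) : HasRadiusOne d := fun r hr0 hr =>
  (hc r hr0 hr).of_nonneg_of_le (fun m => by positivity) fun m => by gcongr; exact h m

/-- A radius strictly between `r` and `1` leaves a geometric factor that absorbs the polynomial
weight. -/
theorem HasRadiusOne.summable_pow_mul (hc : HasRadiusOne c) (p : ℕ) {r : ℝ} (hr0 : 0 ≤ r)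
    (hr : r < 1) : Summable fun m : ℕ => ((m : ℝ) + 1) ^ p * ‖c m‖ * r ^ m := by
  obtain ⟨ρ, h1, h2⟩ := exists_between hr
  have hρ : 0 < ρ := hr0.trans_lt h1
  obtain ⟨C, hC0, hC⟩ := exists_pow_mul_geometric_le p (x := r / ρ) (by positivity)
    ((div_lt_one hρ).2 h1)
  refine Summable.of_nonneg_of_le (fun m => by positivity) (fun m => ?_)
    ((hc ρ hρ.le h2).mul_left C)
  calc ((m : ℝ) + 1) ^ p * ‖c m‖ * r ^ m
      = ((m : ℝ) + 1) ^ p * (r / ρ) ^ m * (‖c m‖ * ρ ^ m) := by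
        rw [div_pow]; field_simp
    _ ≤ C * (‖c m‖ * ρ ^ m) := by gcongr; exact hC m

theorem descFactorial_le_pow (k n : ℕ) :
    ((k + n).descFactorial n : ℝ) ≤ (((k + n : ℕ) : ℝ) + 1) ^ n := by
  have h : (k + n).descFactorial n ≤ (k + n + 1) ^ n :=
    (Nat.descFactorial_le_pow _ _).trans (Nat.pow_le_pow_left (Nat.le_succ _) _)
  exact_mod_cast h

/-- Serves both differentiation and the removal of initial terms followed by division by a power of
the variable. -/
theorem HasRadiusOne.shift (hc : HasRadiusOne c) (p n : ℕ) {d : ℕ → E}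
    (hd : ∀ k, ‖d k‖ ≤ (((k + n : ℕ) : ℝ) + 1) ^ p * ‖c (k + n)‖) : HasRadiusOne d := by
  refine HasRadiusOne.of_bounded fun r hr0 hr => ?_
  have h := hc.summable_pow_mul p hr0.le hr
  refine ⟨(∑' m : ℕ, ((m : ℝ) + 1) ^ p * ‖c m‖ * r ^ m) / r ^ n, fun k => ?_⟩
  rw [le_div_iff₀ (by positivity)]
  calc ‖d k‖ * r ^ k * r ^ n = ‖d k‖ * r ^ (k + n) := by rw [pow_add]; ring
    _ ≤ (((k + n : ℕ) : ℝ) + 1) ^ p * ‖c (k + n)‖ * r ^ (k + n) := by gcongr; exact hd k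
    _ ≤ _ := h.le_tsum (k + n) fun j _ => by positivity

variable [NormedSpace ℝ E]

theorem norm_derivCoeff_le (n : ℕ) (c : ℕ → E) (k : ℕ) :
    ‖derivCoeff n c k‖ ≤ (((k + n : ℕ) : ℝ) + 1) ^ n * ‖c (k + n)‖ := by
  rw [derivCoeff, norm_smul, Real.norm_of_nonneg (by positivity)]
  gcongr
  exact descFactorial_le_pow k n

theorem HasRadiusOne.derivCoeff (hc : HasRadiusOne c) (n : ℕ) : HasRadiusOne (derivCoeff n c) :=
  hc.shift n n (norm_derivCoeff_le n c)

theorem derivCoeff_succ (n : ℕ) (c : ℕ → E) (k : ℕ) :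
    derivCoeff (n + 1) c k = ((k : ℝ) + 1) • derivCoeff n c (k + 1) := by
  rw [derivCoeff, derivCoeff, smul_smul, Nat.descFactorial_succ,
    show k + 1 + n = k + (n + 1) by ring]
  congr 1
  rw [show k + (n + 1) - n = k + 1 by omega]
  push_cast
  ring

end Coefficients

/-! ### Power series on a slice and their derivatives in the real direction -/

section SliceSeries

variable {i : ℍ[ℝ]} {c : ℕ → ℍ[ℝ]}

/-- The sum of a power series with quaternionic coefficients on the slice `ℂ(i)`. -/
def sliceSeries (i : ℍ[ℝ]) (c : ℕ → ℍ[ℝ]) (z : ℂ) : ℍ[ℝ] :=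
  ∑' m : ℕ, sliceMap i (z ^ m) * c m

theorem norm_sliceMap_pow_mul (hi : i ∈ imagSphere) (z : ℂ) (m : ℕ) (q : ℍ[ℝ]) :
    ‖sliceMap i (z ^ m) * q‖ = ‖q‖ * ‖z‖ ^ m := by
  rw [norm_mul, norm_sliceMap hi, norm_pow, mul_comm]

theorem HasRadiusOne.summable_norm (hc : HasRadiusOne c) (hi : i ∈ imagSphere) {z : ℂ}
    (hz : ‖z‖ < 1) : Summable fun m => ‖sliceMap i (z ^ m) * c m‖ := by
  simp_rw [norm_sliceMap_pow_mul hi]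
  exact hc _ (norm_nonneg _) hz

theorem HasRadiusOne.hasSum (hc : HasRadiusOne c) (hi : i ∈ imagSphere) {z : ℂ}
    (hz : ‖z‖ < 1) : HasSum (fun m => sliceMap i (z ^ m) * c m) (sliceSeries i c z) :=
  (hc.summable_norm hi hz).of_norm.hasSum

theorem HasRadiusOne.of_summable (hi : i ∈ imagSphere)
    (h : ∀ z : ℂ, ‖z‖ < 1 → Summable fun m => sliceMap i (z ^ m) * c m) : HasRadiusOne c := by
  refine HasRadiusOne.of_bounded fun r hr0 hr => ?_
  have hr' : ‖(r : ℂ)‖ = r := by simp [hr0.le]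
  have := (h r (by rwa [hr'])).tendsto_atTop_zero.norm
  obtain ⟨M, hM⟩ := this.bddAbove_range
  refine ⟨M, fun m => ?_⟩
  have := hM ⟨m, rfl⟩
  simpa only [norm_sliceMap_pow_mul hi, hr'] using this

theorem hasDerivAt_sliceMap_pow (i : ℍ[ℝ]) (z : ℂ) (m : ℕ) (q : ℍ[ℝ]) (t : ℝ) :
    HasDerivAt (fun t : ℝ => sliceMap i ((z + t) ^ m) * q)
      (sliceMap i ((m : ℂ) * (z + t) ^ (m - 1)) * q) t := by
  have h1 : HasDerivAt (fun t : ℝ => (z + t) ^ m) ((m : ℂ) * (z + t) ^ (m - 1)) t := by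
    have := (((hasDerivAt_id (t : ℂ)).const_add z).pow m).comp_ofReal
    simpa using this
  exact (((sliceCLM i).hasFDerivAt.comp_hasDerivAt t h1)).mul_const q

theorem sliceMap_natCast_mul (i : ℍ[ℝ]) (m : ℕ) (z : ℂ) :
    sliceMap i ((m : ℂ) * z) = (m : ℝ) • sliceMap i z := by
  rw [← sliceMap_smul, Complex.real_smul]; simp

theorem HasRadiusOne.hasDerivAt_sliceSeries (hc : HasRadiusOne c) (hi : i ∈ imagSphere) {z : ℂ}
    (hz : ‖z‖ < 1) :
    HasDerivAt (fun t : ℝ => sliceSeries i c (z + t)) (sliceSeries i (SliceBesov.derivCoeff 1 c) z)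
      0 := by
  obtain ⟨ρ, h1, h2⟩ := exists_between hz
  have hρ : 0 < ρ := (norm_nonneg _).trans_lt h1
  have hsum : Summable fun m : ℕ => (m : ℝ) * ‖c m‖ * ρ ^ (m - 1) := by
    rw [← summable_nat_add_iff 1]
    refine ((hc.derivCoeff 1) ρ hρ.le h2).congr fun m => ?_
    simp [SliceBesov.derivCoeff, norm_smul, abs_of_nonneg (show (0 : ℝ) ≤ (m : ℝ) + 1 by positivity)]
  have hball : ∀ t ∈ Metric.ball (0 : ℝ) (ρ - ‖z‖), ‖z + t‖ ≤ ρ := by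
    intro t ht
    have : |t| < ρ - ‖z‖ := by simpa using ht
    calc ‖z + t‖ ≤ ‖z‖ + ‖(t : ℂ)‖ := norm_add_le _ _
      _ ≤ ρ := by rw [Complex.norm_real, Real.norm_eq_abs]; linarith
  have h0 : (0 : ℝ) ∈ Metric.ball (0 : ℝ) (ρ - ‖z‖) := by simpa using h1
  have key := hasDerivAt_tsum_of_isPreconnected hsum Metric.isOpen_ball
    (convex_ball (0 : ℝ) (ρ - ‖z‖)).isPreconnected
    (fun m t _ => hasDerivAt_sliceMap_pow i z m (c m) t)
    (fun m t ht => ?_) h0 (by simpa using (hc.hasSum hi hz).summable) h0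
  · refine key.congr_deriv ?_
    -- The term of index `0` carries the factor `0`, so the truncated exponent `m - 1` is harmless
    -- there; the rest is the shifted series.
    rw [Summable.tsum_eq_zero_add]
    · simp only [sliceSeries, Nat.cast_zero, zero_mul, sliceMap_zero, zero_add, Complex.ofReal_zero,
        add_zero, Nat.add_sub_cancel]
      refine tsum_congr fun m => ?_
      rw [sliceMap_natCast_mul, SliceBesov.derivCoeff]
      simp
    · refine Summable.of_norm_bounded hsum fun m => ?_
      rw [norm_mul, norm_sliceMap hi, norm_mul, norm_pow, Complex.norm_natCast, mul_right_comm]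
      gcongr
      exact hball 0 h0
  · rw [norm_mul, norm_sliceMap hi, norm_mul, norm_pow, Complex.norm_natCast, mul_right_comm]
    gcongr
    exact hball t ht

theorem derivCoeff_one_derivCoeff (n : ℕ) (c : ℕ → ℍ[ℝ]) :
    derivCoeff 1 (derivCoeff n c) = derivCoeff (n + 1) c := by
  funext k
  rw [derivCoeff_succ n c k, derivCoeff]
  simp

theorem HasRadiusOne.realPartialDeriv_eq (hc : HasRadiusOne c) (hi : i ∈ imagSphere)
    {f : ℍ[ℝ] → ℍ[ℝ]} (hf : ∀ z : ℂ, ‖z‖ < 1 → f (sliceMap i z) = sliceSeries i c z) (n : ℕ) :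
    ∀ {z : ℂ}, ‖z‖ < 1 →
      realPartialDeriv n f (sliceMap i z) = sliceSeries i (SliceBesov.derivCoeff n c) z := by
  induction n with
  | zero =>
    intro z hz
    simp only [realPartialDeriv, iteratedDeriv_zero, Quaternion.coe_zero, add_zero, hf z hz]
    simp [sliceSeries, SliceBesov.derivCoeff]
  | succ n ih =>
    intro z hz
    -- Differentiating at time `s` is differentiating at time `0` from the translated base point,
    -- which stays in the slice, so the induction hypothesis applies for all small `s`.
    have hshift : ∀ s : ℝ, iteratedDeriv n (fun t : ℝ => f (sliceMap i z + (t : ℍ[ℝ]))) s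
        = realPartialDeriv n f (sliceMap i (z + s)) := by
      intro s
      have := congrFun (iteratedDeriv_comp_const_add n
        (fun t : ℝ => f (sliceMap i z + (t : ℍ[ℝ]))) s) 0
      simp only [add_zero] at this
      rw [← this, realPartialDeriv]
      congr 1
      funext t
      rw [sliceMap_add, sliceMap_ofReal, Quaternion.coe_add, add_assoc]
    have hnear : ∀ᶠ s : ℝ in 𝓝 0, ‖z + (s : ℂ)‖ < 1 := by
      have : Continuous fun s : ℝ => ‖z + (s : ℂ)‖ := by fun_prop
      exact this.continuousAt.eventually_lt continuousAt_const (by simpa using hz)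
    rw [realPartialDeriv, iteratedDeriv_succ]
    have heq : (iteratedDeriv n fun t : ℝ => f (sliceMap i z + (t : ℍ[ℝ]))) =ᶠ[𝓝 0]
        fun s : ℝ => sliceSeries i (SliceBesov.derivCoeff n c) (z + s) := by
      filter_upwards [hnear] with s hs
      rw [hshift, ih hs]
    rw [heq.deriv_eq, ((hc.derivCoeff n).hasDerivAt_sliceSeries hi hz).deriv,
      derivCoeff_one_derivCoeff]

theorem sliceSeries_zero (i : ℍ[ℝ]) (c : ℕ → ℍ[ℝ]) : sliceSeries i c 0 = c 0 := by
  rw [sliceSeries, tsum_eq_single 0]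
  · simp
  · intro m hm
    simp [hm]

/-- The right-hand side involves `f` near the origin on the real axis only and not the slice. This
is what identifies the expansions on different slices. -/
theorem HasRadiusOne.coeff_eq (hc : HasRadiusOne c) (hi : i ∈ imagSphere)
    {f : ℍ[ℝ] → ℍ[ℝ]} (hf : ∀ z : ℂ, ‖z‖ < 1 → f (sliceMap i z) = sliceSeries i c z) (n : ℕ) :
    c n = ((n.factorial : ℝ)⁻¹) • realPartialDeriv n f 0 := by
  have := hc.realPartialDeriv_eq hi hf n (z := 0) (by simp)
  rw [sliceMap_zero, sliceSeries_zero] at this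
  rw [this, SliceBesov.derivCoeff, zero_add, Nat.descFactorial_self, smul_smul,
    inv_mul_cancel₀ (by positivity), one_smul]

end SliceSeries

/-! ### Slice regularity as holomorphy, and the Taylor expansion -/

section SliceModule

/-- The quaternions as a complex vector space, `x + y√-1` acting as left multiplication by
`x + y i`. -/
def SliceModule (_ : imagSphere) : Type := ℍ[ℝ]

variable (i : imagSphere)

instance : NormedAddCommGroup (SliceModule i) := inferInstanceAs (NormedAddCommGroup ℍ[ℝ])

instance : CompleteSpace (SliceModule i) := inferInstanceAs (CompleteSpace ℍ[ℝ])

/-- `sliceMap i` as a ring homomorphism. -/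
def sliceRingHom : ℂ →+* ℍ[ℝ] where
  toFun := sliceMap i
  map_one' := sliceMap_one i
  map_mul' := sliceMap_mul i.2
  map_zero' := sliceMap_zero i
  map_add' := sliceMap_add i

instance : Module ℂ (SliceModule i) :=
  letI : Module ℍ[ℝ] (SliceModule i) := inferInstanceAs (Module ℍ[ℝ] ℍ[ℝ])
  Module.compHom (SliceModule i) (sliceRingHom i)

/-- The identity map. -/
def toSliceModule (q : ℍ[ℝ]) : SliceModule i := q

theorem smul_toSliceModule (z : ℂ) (q : ℍ[ℝ]) :
    z • toSliceModule i q = toSliceModule i (sliceMap i z * q) := rfl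

instance : NormedSpace ℂ (SliceModule i) where
  norm_smul_le z q := by
    let p : ℍ[ℝ] := q
    change ‖sliceMap i z * p‖ ≤ ‖z‖ * ‖p‖
    rw [norm_mul, norm_sliceMap i.2]

variable {i}

/-- Multiplying the Cauchy-Riemann equation by `i` gives `L i = i * L 1`. Hence on `ℂ(i)` the real
differential is `w ↦ w * L 1`, which is complex linear for the left module structure. -/
theorem SliceRegularOn.differentiableOn {f : ℍ[ℝ] → ℍ[ℝ]} (hf : SliceRegularOn f unitBall) :
    DifferentiableOn ℂ (fun z : ℂ => toSliceModule i (f (sliceMap i z))) (Metric.ball 0 1) := by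
  intro z hz
  have hz' : sliceMap i z ∈ unitBall := (sliceMap_mem_unitBall i.2).2 (by simpa using hz)
  set L := fderiv ℝ f (sliceMap i z) with hL
  have h1 : HasFDerivAt f L (sliceMap i z) :=
    (hf.1.differentiableAt (Metric.isOpen_ball.mem_nhds hz')).hasFDerivAt
  have hCR := hf.2 i i.2 _ ⟨hz', z, rfl⟩
  rw [← hL] at hCR
  have hLi : L i = i * L 1 := by
    have : (i : ℍ[ℝ]) * (L 1 + i * L i) = 0 := by rw [hCR, mul_zero]
    rw [mul_add, ← mul_assoc, imagSphere_mul_self i.2, neg_one_mul] at this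
    exact (add_neg_eq_zero.1 this).symm
  have hLz : ∀ w : ℂ, L (sliceMap i w) = sliceMap i w * L 1 := by
    intro w
    have : sliceMap i w = w.re • (1 : ℍ[ℝ]) + w.im • (i : ℍ[ℝ]) := by
      simp only [sliceMap, ← Quaternion.coe_mul_eq_smul, mul_one]
    rw [this, map_add, map_smul, map_smul, hLi, add_mul, smul_mul_assoc, smul_mul_assoc, one_mul]
  have h2 := h1.comp z (sliceCLM i).hasFDerivAt
  refine HasDerivAt.differentiableAt (f' := toSliceModule i (L 1)) ?_ |>.differentiableWithinAt
  rw [hasDerivAt_iff_isLittleO]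
  have h3 := h2.isLittleO
  have h4 : (fun w => f (sliceMap i w) - f (sliceMap i z) - sliceMap i (w - z) * L 1)
      =o[𝓝 z] fun w => w - z := by
    refine h3.congr_left fun w => ?_
    simp [hLz]
  exact Asymptotics.IsLittleO.of_norm_left (Asymptotics.IsLittleO.norm_left h4)

/-- Each slice has its own Taylor series by complex analysis; all slices share the real axis, so by
`HasRadiusOne.coeff_eq` the coefficients coincide. -/
theorem SliceRegularOn.exists_coeff {f : ℍ[ℝ] → ℍ[ℝ]} (hf : SliceRegularOn f unitBall) :
    ∃ c : ℕ → ℍ[ℝ], HasRadiusOne c ∧ ∀ i ∈ imagSphere, ∀ z : ℂ, ‖z‖ < 1 →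
      f (sliceMap i z) = sliceSeries i c z := by
  have key : ∀ i ∈ imagSphere, ∃ c : ℕ → ℍ[ℝ], HasRadiusOne c ∧ ∀ z : ℂ, ‖z‖ < 1 →
      f (sliceMap i z) = sliceSeries i c z := by
    intro i hi
    let j : imagSphere := ⟨i, hi⟩
    obtain ⟨d, hd⟩ : ∃ d : ℕ → ℍ[ℝ], ∀ m, iteratedDeriv m
        (fun z : ℂ => toSliceModule j (f (sliceMap i z))) 0 = toSliceModule j (d m) :=
      ⟨fun m => @id (SliceModule j) (iteratedDeriv m
        (fun z : ℂ => toSliceModule j (f (sliceMap i z))) 0), fun _ => rfl⟩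
    let c : ℕ → ℍ[ℝ] := fun m => sliceMap i ((m.factorial : ℂ)⁻¹) * d m
    have hs : ∀ z : ℂ, ‖z‖ < 1 →
        HasSum (fun m => sliceMap i (z ^ m) * c m) (f (sliceMap i z)) := by
      intro z hz
      have h := Complex.hasSum_taylorSeries_on_ball (hf.differentiableOn (i := j))
        (z := z) (by simpa using hz)
      have hterm : ∀ m : ℕ, (m.factorial : ℂ)⁻¹ • (z - 0) ^ m • iteratedDeriv m
          (fun z : ℂ => toSliceModule j (f (sliceMap j z))) 0
          = toSliceModule j (sliceMap i (z ^ m) * c m) := by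
        intro m
        rw [hd, smul_toSliceModule, smul_toSliceModule, sub_zero, ← mul_assoc, ← sliceMap_mul hi,
          mul_comm, sliceMap_mul hi, mul_assoc]
      rw [funext hterm] at h
      exact h
    have hc : HasRadiusOne c := HasRadiusOne.of_summable hi fun z hz => (hs z hz).summable
    exact ⟨c, hc, fun z hz => (hs z hz).unique (hc.hasSum hi hz)⟩
  obtain ⟨i, hi⟩ := imagSphere_nonempty
  obtain ⟨c, hc, hcf⟩ := key i hi
  refine ⟨c, hc, fun j hj z hz => ?_⟩
  obtain ⟨c', hc', hcf'⟩ := key j hj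
  have : c = c' := funext fun m => by rw [hc.coeff_eq hi hcf, hc'.coeff_eq hj hcf']
  rw [this, hcf' z hz]

end SliceModule

/-! ### Möbius transformations: coefficients, derivatives, uniform integral bound -/

section Moebius

variable {i : ℍ[ℝ]}

/-- The Taylor coefficients of the Möbius transformation `z ↦ (a - z) / (1 - \bar a z)`. -/
def moebCoeff (a : ℂ) : ℕ → ℂ
  | 0 => a
  | m + 1 => (starRingEnd ℂ a) ^ m * ((‖a‖ ^ 2 - 1 : ℝ) : ℂ)

theorem norm_moebCoeff_succ (a : ℂ) (m : ℕ) :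
    ‖moebCoeff a (m + 1)‖ = ‖a‖ ^ m * |‖a‖ ^ 2 - 1| := by
  rw [moebCoeff, norm_mul, norm_pow, RCLike.norm_conj, Complex.norm_real, Real.norm_eq_abs]

theorem abs_normSq_sub_one_le {a : ℂ} (ha : ‖a‖ < 1) : |‖a‖ ^ 2 - 1| ≤ 1 := by
  rw [abs_le]
  constructor <;> nlinarith [norm_nonneg a]

theorem norm_moebCoeff_le {a : ℂ} (ha : ‖a‖ < 1) (m : ℕ) : ‖moebCoeff a m‖ ≤ 1 := by
  cases m with
  | zero => exact ha.le
  | succ m =>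
    rw [norm_moebCoeff_succ]
    exact mul_le_one₀ (pow_le_one₀ (norm_nonneg _) ha.le) (abs_nonneg _) (abs_normSq_sub_one_le ha)

theorem continuous_moebCoeff (m : ℕ) : Continuous fun a => moebCoeff a m := by
  cases m with
  | zero => exact continuous_id
  | succ m =>
    simp only [moebCoeff]
    fun_prop

/-- The point `a` and its conjugate lie in the same commutative plane, so the slice regular inverse
is a geometric series and the product is the classical one, although `q` is an arbitrary quaternion.
-/
theorem moebius_eq (hi : i ∈ imagSphere) (a : ℂ) (q : ℍ[ℝ]) :
    moebius (sliceMap i a) q = ∑' m : ℕ, q ^ m * sliceMap i (moebCoeff a m) := by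
  set A := sliceMap i a with hA
  set B := sliceMap i (starRingEnd ℂ a) with hB
  have hstar : star A = B := sliceMap_star hi a
  have hgeom : PowerSeries.mk (fun m => B ^ m) *
      (1 - PowerSeries.X * PowerSeries.C (star A)) = 1 := by
    rw [PowerSeries.X_mul, mul_sub, mul_one, ← mul_assoc, hstar]
    ext1 m
    cases m with
    | zero => simp
    | succ m =>
      rw [map_sub, PowerSeries.coeff_succ_mul_X, PowerSeries.coeff_mul_C, PowerSeries.coeff_mk,
        PowerSeries.coeff_mk, pow_succ, sub_self, PowerSeries.coeff_one, if_neg (by omega)]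
  -- The geometric series is a left inverse and `invOfUnit` a right inverse, so they agree by
  -- associativity.
  have hinv : PowerSeries.invOfUnit (1 - PowerSeries.X * PowerSeries.C (star A)) 1
      = PowerSeries.mk (fun m => B ^ m) := by
    have h1 := PowerSeries.mul_invOfUnit (1 - PowerSeries.X * PowerSeries.C (star A)) 1 (by simp)
    calc _ = (PowerSeries.mk (fun m => B ^ m) *
        (1 - PowerSeries.X * PowerSeries.C (star A))) *
        PowerSeries.invOfUnit (1 - PowerSeries.X * PowerSeries.C (star A)) 1 := by
          rw [hgeom, one_mul]
      _ = _ := by rw [mul_assoc, h1, mul_one]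
  rw [moebius, hinv, seriesSum]
  refine tsum_congr fun m => ?_
  congr 1
  rw [mul_sub, map_sub, PowerSeries.coeff_mul_C, PowerSeries.coeff_mk]
  cases m with
  | zero => simp [moebCoeff, hA]
  | succ m =>
    rw [PowerSeries.coeff_succ_mul_X, PowerSeries.coeff_mk, pow_succ, mul_assoc]
    have : B * A = sliceMap i ((‖a‖ ^ 2 : ℝ) : ℂ) := by
      rw [hA, hB, ← sliceMap_mul hi, mul_comm, Complex.mul_conj, Complex.normSq_eq_norm_sq]
    rw [this, hB, ← sliceMap_pow hi, ← sliceMap_mul hi, ← sliceMap_sub, moebCoeff]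
    congr 1
    push_cast
    ring

theorem moebius_sliceMap {j : ℍ[ℝ]} (hi : i ∈ imagSphere) (hj : j ∈ imagSphere) (a z : ℂ) :
    moebius (sliceMap i a) (sliceMap j z) = sliceSeries j (fun m => sliceMap i (moebCoeff a m)) z := by
  rw [moebius_eq hi, sliceSeries]
  simp_rw [sliceMap_pow hj]

theorem hasRadiusOne_moebCoeff {a : ℂ} (ha : ‖a‖ < 1) : HasRadiusOne (moebCoeff a) :=
  HasRadiusOne.of_norm_le (norm_moebCoeff_le ha)

theorem hasRadiusOne_sliceMap (hi : i ∈ imagSphere) {s : ℕ → ℂ} (hs : HasRadiusOne s) :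
    HasRadiusOne fun m => sliceMap i (s m) :=
  hs.mono fun _ => (norm_sliceMap hi _).le

/-- The `n`-th derivative of `z ↦ (a - z) / (1 - \bar a z)`. -/
theorem hasSum_derivCoeff_moebCoeff {n : ℕ} (hn : 0 < n) {a z : ℂ} (ha : ‖a‖ < 1) (hz : ‖z‖ < 1) :
    HasSum (fun k => z ^ k * derivCoeff n (moebCoeff a) k)
      (n.factorial * (starRingEnd ℂ a) ^ (n - 1) * ((‖a‖ ^ 2 - 1 : ℝ) : ℂ) /
        (1 - z * starRingEnd ℂ a) ^ (n + 1)) := by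
  have hr : ‖z * starRingEnd ℂ a‖ < 1 := by
    rw [norm_mul, RCLike.norm_conj]
    nlinarith [norm_nonneg z, norm_nonneg a]
  have h := (hasSum_choose_mul_geometric_of_norm_lt_one n hr).mul_left
    (n.factorial * (starRingEnd ℂ a) ^ (n - 1) * ((‖a‖ ^ 2 - 1 : ℝ) : ℂ))
  rw [mul_one_div] at h
  refine h.congr_fun fun k => ?_
  obtain ⟨p, rfl⟩ : ∃ p, n = p + 1 := ⟨n - 1, by omega⟩
  rw [derivCoeff, ← add_assoc, moebCoeff, Nat.descFactorial_eq_factorial_mul_choose,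
    Complex.real_smul]
  push_cast
  rw [mul_pow, pow_add]
  ring

theorem sliceSeries_derivCoeff_moebCoeff (hi : i ∈ imagSphere) {n : ℕ} (hn : 0 < n) {a z : ℂ}
    (ha : ‖a‖ < 1) (hz : ‖z‖ < 1) :
    sliceSeries i (fun k => sliceMap i (derivCoeff n (moebCoeff a) k)) z
      = sliceMap i (n.factorial * (starRingEnd ℂ a) ^ (n - 1) * ((‖a‖ ^ 2 - 1 : ℝ) : ℂ) /
        (1 - z * starRingEnd ℂ a) ^ (n + 1)) := by
  have h := (sliceCLM i).hasSum (hasSum_derivCoeff_moebCoeff hn ha hz)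
  rw [sliceCLM_apply] at h
  rw [← h.tsum_eq, sliceSeries]
  refine tsum_congr fun k => ?_
  rw [← sliceMap_mul hi]
  rfl

theorem norm_sliceSeries_derivCoeff_moebCoeff_le (hi : i ∈ imagSphere) {n : ℕ} (hn : 0 < n)
    {a z : ℂ} (ha : ‖a‖ < 1) (hz : ‖z‖ < 1) :
    ‖sliceSeries i (fun k => sliceMap i (derivCoeff n (moebCoeff a) k)) z‖
      ≤ n.factorial * (1 - ‖a‖ ^ 2) / ‖1 - z * starRingEnd ℂ a‖ ^ (n + 1) := by
  rw [sliceSeries_derivCoeff_moebCoeff hi hn ha hz, norm_sliceMap hi, norm_div, norm_mul, norm_mul,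
    norm_pow, norm_pow, RCLike.norm_conj, Complex.norm_natCast, Complex.norm_real,
    Real.norm_eq_abs, abs_sub_comm, abs_of_nonneg (by nlinarith [norm_nonneg a])]
  have h0 : 0 ≤ 1 - ‖a‖ ^ 2 := by nlinarith [norm_nonneg a]
  gcongr
  exact mul_le_of_le_one_right (by positivity) (pow_le_one₀ (norm_nonneg _) ha.le)

theorem one_sub_norm_le_norm_one_sub_mul_conj {a z : ℂ} (hz : ‖z‖ ≤ 1) (ha : ‖a‖ ≤ 1) :
    1 - ‖a‖ ≤ ‖1 - z * starRingEnd ℂ a‖ ∧ 1 - ‖z‖ ≤ ‖1 - z * starRingEnd ℂ a‖ := by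
  have h : 1 - ‖z‖ * ‖a‖ ≤ ‖1 - z * starRingEnd ℂ a‖ := by
    have := norm_sub_norm_le (1 : ℂ) (z * starRingEnd ℂ a)
    rwa [norm_one, norm_mul, RCLike.norm_conj] at this
  constructor <;> nlinarith [norm_nonneg z, norm_nonneg a]

/-- The weight `(1 - |z|²)ⁿ⁻² / π` of the Besov seminorm with respect to the area measure. -/
def besovWeight (n : ℕ) (z : ℂ) : ℝ := (1 - ‖z‖ ^ 2) ^ (n - 2) / Real.pi

theorem continuous_besovWeight (n : ℕ) : Continuous (besovWeight n) := by
  unfold besovWeight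
  fun_prop

theorem besovWeight_nonneg (n : ℕ) {z : ℂ} (hz : ‖z‖ < 1) : 0 ≤ besovWeight n z := by
  have : 0 ≤ 1 - ‖z‖ ^ 2 := by nlinarith [norm_nonneg z]
  unfold besovWeight
  positivity

/-- Since `1 - |z|² ≤ 2 |1 - zā|`, the weight cancels `n - 2` of the `n + 1` factors in the
denominator. This reduces every `n` to the same cubic kernel. -/
theorem besovWeight_mul_kernel_le {n : ℕ} (hn : 1 < n) {a z : ℂ} (ha : ‖a‖ < 1) (hz : ‖z‖ < 1) :
    besovWeight n z * (n.factorial * (1 - ‖a‖ ^ 2) / ‖1 - z * starRingEnd ℂ a‖ ^ (n + 1))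
      ≤ n.factorial * 2 ^ n * ((1 - ‖a‖) / ‖1 - z * starRingEnd ℂ a‖ ^ 3) := by
  set N := ‖1 - z * starRingEnd ℂ a‖ with hN
  obtain ⟨h1, h2⟩ := one_sub_norm_le_norm_one_sub_mul_conj hz.le ha.le
  rw [← hN] at h1 h2
  have hN0 : 0 < N := lt_of_lt_of_le (by linarith) h1
  obtain ⟨p, rfl⟩ : ∃ p, n = p + 2 := ⟨n - 2, by omega⟩
  have hw : besovWeight (p + 2) z ≤ (2 * N) ^ p := by
    have h3 : 0 ≤ 1 - ‖z‖ ^ 2 := by nlinarith [norm_nonneg z]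
    have h4 : 1 - ‖z‖ ^ 2 ≤ 2 * N := by nlinarith [norm_nonneg z]
    unfold besovWeight
    rw [Nat.add_sub_cancel]
    exact (div_le_self (by positivity) (by linarith [Real.pi_gt_three])).trans (by gcongr)
  have ha2 : 1 - ‖a‖ ^ 2 ≤ 2 * (1 - ‖a‖) := by nlinarith [norm_nonneg a]
  have ha0 : 0 ≤ 1 - ‖a‖ ^ 2 := by nlinarith [norm_nonneg a]
  have ha1 : 0 ≤ 1 - ‖a‖ := by linarith
  calc _ ≤ (2 * N) ^ p * ((p + 2).factorial * (2 * (1 - ‖a‖)) / N ^ (p + 2 + 1)) := by gcongr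
    _ = (p + 2).factorial * 2 ^ (p + 1) * ((1 - ‖a‖) / N ^ 3) := by
      field_simp
      ring
    _ ≤ _ := by
      gcongr
      · norm_num
      · omega

/-- For `|a| < 1/2` the integrand is at most `8`. Otherwise, with `δ = 1 - |a|`, it is dominated by
a multiple of `δ⁻² φ((z - b)/δ)` with `φ(z) = (1 + |z|)⁻³`. The integral of that over the plane does
not depend on `δ` or `b`, and it is finite because the exponent `3` exceeds the dimension `2`. -/
theorem lintegral_one_sub_norm_div_cube_le :
    ∃ C : ENNReal, C < ⊤ ∧ ∀ a : ℂ, ‖a‖ < 1 →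
      ∫⁻ z in Metric.ball (0 : ℂ) 1,
        ENNReal.ofReal ((1 - ‖a‖) / ‖1 - z * starRingEnd ℂ a‖ ^ 3) ≤ C := by
  set φ : ℂ → ℝ := fun z => (1 + ‖z‖) ^ (-3 : ℝ) with hφ
  have hφi : Integrable φ := integrable_one_add_norm (by
    rw [Complex.finrank_real_complex]; norm_num)
  have hφ0 : ∀ z, 0 ≤ φ z := fun z => by positivity
  refine ⟨ENNReal.ofReal (54 * ∫ z, φ z) + 8 * volume (Metric.ball (0 : ℂ) 1),
    ENNReal.add_lt_top.2 ⟨ENNReal.ofReal_lt_top,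
      ENNReal.mul_lt_top (by simp) measure_ball_lt_top⟩, fun a ha => ?_⟩
  rcases lt_or_ge ‖a‖ (1 / 2) with h | h
  · refine le_trans ?_ le_add_self
    rw [← setLIntegral_const]
    refine setLIntegral_mono' measurableSet_ball fun z hz => ?_
    have hz : ‖z‖ < 1 := by simpa using hz
    have h1 := (one_sub_norm_le_norm_one_sub_mul_conj hz.le ha.le).1
    rw [show (8 : ENNReal) = ENNReal.ofReal 8 by simp]
    apply ENNReal.ofReal_le_ofReal
    have h2 : (1 / 2 : ℝ) ≤ ‖1 - z * starRingEnd ℂ a‖ := by linarith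
    rw [div_le_iff₀ (by positivity)]
    have h3 : (1 / 2 : ℝ) ^ 3 ≤ ‖1 - z * starRingEnd ℂ a‖ ^ 3 := by gcongr
    nlinarith [norm_nonneg a]
  · refine le_trans ?_ le_self_add
    set δ := 1 - ‖a‖ with hδ
    have hδ0 : 0 < δ := by rw [hδ]; linarith
    have ha0 : starRingEnd ℂ a ≠ 0 := by
      rw [ne_eq, map_eq_zero]; intro h0; rw [h0, norm_zero] at h; norm_num at h
    -- The pole of `T_a`, at which the kernel concentrates.
    set b := (starRingEnd ℂ a)⁻¹ with hb
    have hpt : ∀ z ∈ Metric.ball (0 : ℂ) 1, δ / ‖1 - z * starRingEnd ℂ a‖ ^ 3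
        ≤ 54 * ((δ ^ 2)⁻¹ * φ (δ⁻¹ • (z - b))) := by
      intro z hz
      have hz : ‖z‖ < 1 := by simpa using hz
      have h1 := (one_sub_norm_le_norm_one_sub_mul_conj hz.le ha.le).1
      have h2 : ‖z - b‖ ≤ 2 * ‖1 - z * starRingEnd ℂ a‖ := by
        have : 1 - z * starRingEnd ℂ a = -((starRingEnd ℂ a) * (z - b)) := by
          rw [mul_sub, hb, mul_inv_cancel₀ ha0]; ring
        rw [this, norm_neg, norm_mul, RCLike.norm_conj]
        nlinarith [norm_nonneg (z - b)]
      -- From `δ ≤ N` and `|z - b| ≤ 2N` comes `(δ + |z - b|)³ ≤ 27 N³`; the constant `54` is larger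
      -- than needed.
      set N := ‖1 - z * starRingEnd ℂ a‖
      have hN0 : 0 < N := lt_of_lt_of_le hδ0 h1
      have h3 : δ + ‖z - b‖ ≤ 3 * N := by linarith
      have hφz : φ (δ⁻¹ • (z - b)) = δ ^ 3 / (δ + ‖z - b‖) ^ 3 := by
        simp only [hφ]
        rw [norm_smul, Real.norm_of_nonneg (by positivity), Real.rpow_neg (by positivity),
          show (3 : ℝ) = (3 : ℕ) by norm_num, Real.rpow_natCast]
        field_simp
      have hp : 0 < δ + ‖z - b‖ := by positivity
      rw [hφz]
      have h4 : (δ + ‖z - b‖) ^ 3 ≤ 27 * N ^ 3 := by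
        calc _ ≤ (3 * N) ^ 3 := by gcongr
          _ = _ := by ring
      have : 54 * ((δ ^ 2)⁻¹ * (δ ^ 3 / (δ + ‖z - b‖) ^ 3)) = 54 * δ / (δ + ‖z - b‖) ^ 3 := by
        field_simp
      rw [this, div_le_div_iff₀ (by positivity) (by positivity)]
      nlinarith [pow_pos hN0 3]
    have hint : Integrable fun z => (54 : ℝ) * ((δ ^ 2)⁻¹ * φ (δ⁻¹ • (z - b))) :=
      (((hφi.comp_smul (inv_ne_zero hδ0.ne')).comp_sub_right b).const_mul _).const_mul _
    calc _ ≤ ∫⁻ z in Metric.ball (0 : ℂ) 1,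
          ENNReal.ofReal (54 * ((δ ^ 2)⁻¹ * φ (δ⁻¹ • (z - b)))) :=
          setLIntegral_mono' measurableSet_ball fun z hz => ENNReal.ofReal_le_ofReal (hpt z hz)
      _ ≤ ∫⁻ z, ENNReal.ofReal (54 * ((δ ^ 2)⁻¹ * φ (δ⁻¹ • (z - b)))) := setLIntegral_le_lintegral _ _
      _ = ENNReal.ofReal (∫ z, 54 * ((δ ^ 2)⁻¹ * φ (δ⁻¹ • (z - b)))) :=
          (ofReal_integral_eq_lintegral_ofReal hint
            (Eventually.of_forall fun z => by have := hφ0 (δ⁻¹ • (z - b)); positivity)).symm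
      _ = ENNReal.ofReal (54 * ∫ z, φ z) := by
          congr 1
          rw [integral_const_mul, integral_const_mul,
            integral_sub_right_eq_self (fun z => φ (δ⁻¹ • z)) b,
            Measure.integral_comp_inv_smul_of_nonneg _ _ hδ0.le, Complex.finrank_real_complex,
            smul_eq_mul, inv_mul_cancel_left₀ (by positivity)]

end Moebius

/-! ### Comparison of slices, and the Besov condition on a single slice -/

section Slices

variable {i j : ℍ[ℝ]} {c : ℕ → ℍ[ℝ]}

theorem HasRadiusOne.continuousOn_sliceSeries (hc : HasRadiusOne c) (hi : i ∈ imagSphere) :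
    ContinuousOn (sliceSeries i c) (Metric.ball 0 1) := by
  intro z hz
  have hz : ‖z‖ < 1 := by simpa using hz
  obtain ⟨ρ, h1, h2⟩ := exists_between hz
  have hρ : 0 ≤ ρ := (norm_nonneg _).trans h1.le
  have hcont : ContinuousOn (sliceSeries i c) (Metric.ball 0 ρ) := by
    refine continuousOn_tsum (fun m => ?_) (hc ρ hρ h2) fun m w hw => ?_
    · have := continuous_sliceMap i
      fun_prop
    · rw [norm_sliceMap_pow_mul hi]
      have : ‖w‖ < ρ := by simpa using hw
      gcongr
  exact (hcont.continuousAt (Metric.isOpen_ball.mem_nhds (by simpa using h1))).continuousWithinAt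

theorem HasRadiusOne.aestronglyMeasurable_sliceSeries (hc : HasRadiusOne c) (hi : i ∈ imagSphere) :
    AEStronglyMeasurable (sliceSeries i c) (volume.restrict (Metric.ball 0 1)) :=
  (hc.continuousOn_sliceSeries hi).aestronglyMeasurable measurableSet_ball

/-- The representation formula: real and imaginary parts of `zᵐ` give `P` and `Q` independent of the
slice, with value `P + k * Q` on `ℂ(k)`. The values at `z` and at its conjugate on one slice
determine `P` and `i * Q`. -/
theorem HasRadiusOne.norm_sliceSeries_le (hc : HasRadiusOne c) (hi : i ∈ imagSphere)
    (hj : j ∈ imagSphere) {z : ℂ} (hz : ‖z‖ < 1) :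
    ‖sliceSeries j c z‖ ≤ ‖sliceSeries i c z‖ + ‖sliceSeries i c (starRingEnd ℂ z)‖ := by
  have hre : Summable fun m => (z ^ m).re • c m := by
    refine Summable.of_norm_bounded (hc _ (norm_nonneg _) hz) fun m => ?_
    rw [norm_smul, mul_comm, ← norm_pow]
    gcongr
    exact Complex.abs_re_le_norm _
  have him : Summable fun m => (z ^ m).im • c m := by
    refine Summable.of_norm_bounded (hc _ (norm_nonneg _) hz) fun m => ?_
    rw [norm_smul, mul_comm, ← norm_pow]
    gcongr
    exact Complex.abs_im_le_norm _
  set P := ∑' m, (z ^ m).re • c m with hP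
  set Q := ∑' m, (z ^ m).im • c m with hQ
  have hform : ∀ k : ℍ[ℝ], sliceSeries k c z = P + k * Q := by
    intro k
    have h := hre.hasSum.add (him.hasSum.mul_left k)
    rw [← hP, ← hQ] at h
    rw [← h.tsum_eq, sliceSeries]
    refine tsum_congr fun m => ?_
    rw [sliceMap, add_mul, Quaternion.coe_mul_eq_smul, Quaternion.coe_mul_eq_smul, smul_mul_assoc,
      mul_smul_comm]
  have hconj : sliceSeries i c (starRingEnd ℂ z) = P - i * Q := by
    have h := hre.hasSum.sub (him.hasSum.mul_left i)
    rw [← hP, ← hQ] at h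
    rw [← h.tsum_eq, sliceSeries]
    refine tsum_congr fun m => ?_
    rw [← map_pow, sliceMap, add_mul, Quaternion.coe_mul_eq_smul, Quaternion.coe_mul_eq_smul,
      smul_mul_assoc, mul_smul_comm, Complex.conj_re, Complex.conj_im, neg_smul, sub_eq_add_neg]
  have h1 : ‖P‖ ≤ (‖sliceSeries i c z‖ + ‖sliceSeries i c (starRingEnd ℂ z)‖) / 2 := by
    have : (2 : ℝ) • P = sliceSeries i c z + sliceSeries i c (starRingEnd ℂ z) := by
      rw [hform, hconj, two_smul]; abel
    have h := norm_add_le (sliceSeries i c z) (sliceSeries i c (starRingEnd ℂ z))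
    rw [← this, norm_smul, Real.norm_two] at h
    linarith
  have h2 : ‖Q‖ ≤ (‖sliceSeries i c z‖ + ‖sliceSeries i c (starRingEnd ℂ z)‖) / 2 := by
    have : (2 : ℝ) • (i * Q) = sliceSeries i c z - sliceSeries i c (starRingEnd ℂ z) := by
      rw [hform, hconj, two_smul]; abel
    have h := norm_sub_le (sliceSeries i c z) (sliceSeries i c (starRingEnd ℂ z))
    rw [← this, norm_smul, Real.norm_two, norm_mul, hi.2, one_mul] at h
    linarith
  rw [hform]
  calc ‖P + j * Q‖ ≤ ‖P‖ + ‖j * Q‖ := norm_add_le _ _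
    _ = ‖P‖ + ‖Q‖ := by rw [norm_mul, hj.2, one_mul]
    _ ≤ _ := by linarith

/-- The weighted `L¹` norm of a power series on a slice. -/
def sliceNorm (n : ℕ) (i : ℍ[ℝ]) (d : ℕ → ℍ[ℝ]) : ENNReal :=
  ∫⁻ z in Metric.ball (0 : ℂ) 1, ENNReal.ofReal (besovWeight n z) * ‖sliceSeries i d z‖ₑ

theorem setLIntegral_ball_comp_conj (F : ℂ → ENNReal) :
    ∫⁻ z in Metric.ball (0 : ℂ) 1, F (starRingEnd ℂ z) = ∫⁻ z in Metric.ball (0 : ℂ) 1, F z := by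
  have hmp : MeasurePreserving (Complex.conjLIE : ℂ → ℂ) volume volume :=
    Complex.conjLIE.measurePreserving
  have hemb : MeasurableEmbedding (Complex.conjLIE : ℂ → ℂ) :=
    Complex.conjLIE.toHomeomorph.measurableEmbedding
  have := hmp.setLIntegral_comp_preimage_emb hemb F (Metric.ball (0 : ℂ) 1)
  rw [← this]
  have hpre : (Complex.conjLIE : ℂ → ℂ) ⁻¹' Metric.ball 0 1 = Metric.ball 0 1 := by
    ext z; simp
  rw [hpre]
  rfl

theorem HasRadiusOne.sliceNorm_le (hc : HasRadiusOne c) (n : ℕ) (hi : i ∈ imagSphere)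
    (hj : j ∈ imagSphere) : sliceNorm n j c ≤ 2 * sliceNorm n i c := by
  have hmeas : AEMeasurable (fun z => ENNReal.ofReal (besovWeight n z) * ‖sliceSeries i c z‖ₑ)
      (volume.restrict (Metric.ball 0 1)) :=
    (continuous_besovWeight n).measurable.ennreal_ofReal.aemeasurable.mul
      (hc.aestronglyMeasurable_sliceSeries hi).enorm
  calc sliceNorm n j c ≤ ∫⁻ z in Metric.ball (0 : ℂ) 1,
        (ENNReal.ofReal (besovWeight n z) * ‖sliceSeries i c z‖ₑ +
          ENNReal.ofReal (besovWeight n (starRingEnd ℂ z)) *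
            ‖sliceSeries i c (starRingEnd ℂ z)‖ₑ) := by
        refine setLIntegral_mono' measurableSet_ball fun z hz => ?_
        have hz : ‖z‖ < 1 := by simpa using hz
        have hw : besovWeight n (starRingEnd ℂ z) = besovWeight n z := by
          simp only [besovWeight, RCLike.norm_conj]
        rw [hw, ← mul_add]
        gcongr
        have h := hc.norm_sliceSeries_le hi hj hz
        rw [← ofReal_norm, ← ofReal_norm, ← ofReal_norm,
          ← ENNReal.ofReal_add (norm_nonneg _) (norm_nonneg _)]
        exact ENNReal.ofReal_le_ofReal h
    _ = sliceNorm n i c + sliceNorm n i c := by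
        rw [lintegral_add_left' hmeas, setLIntegral_ball_comp_conj
          (fun z => ENNReal.ofReal (besovWeight n z) * ‖sliceSeries i c z‖ₑ)]
        rfl
    _ = _ := (two_mul _).symm

/-- The density of `λ` uses up two of the `n` factors `1 - |z|²`, whence the exponent `n - 2`, a
true subtraction because `n ≥ 2`. -/
theorem besovIntegral_one_eq {n : ℕ} (hn : 1 < n) (hc : HasRadiusOne c) (hi : i ∈ imagSphere)
    {f : ℍ[ℝ] → ℍ[ℝ]} (hf : ∀ z : ℂ, ‖z‖ < 1 → f (sliceMap i z) = sliceSeries i c z) :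
    besovIntegral 1 n f i = sliceNorm n i (derivCoeff n c) := by
  rw [besovIntegral, discMeasure, lintegral_withDensity_eq_lintegral_mul_non_measurable _
    (by fun_prop) (Eventually.of_forall fun z => ENNReal.ofReal_lt_top)]
  refine setLIntegral_congr_fun measurableSet_ball fun z hz => ?_
  have hz : ‖z‖ < 1 := by simpa using hz
  have h0 : 0 < 1 - ‖z‖ ^ 2 := by nlinarith [norm_nonneg z]
  simp only [Pi.mul_apply, ENNReal.rpow_one]
  rw [hc.realPartialDeriv_eq hi hf n hz, enorm_smul, ← mul_assoc]
  congr 1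
  rw [Real.enorm_of_nonneg (by positivity), ← ENNReal.ofReal_mul (by positivity), besovWeight]
  congr 1
  obtain ⟨p, rfl⟩ : ∃ p, n = p + 2 := ⟨n - 2, by omega⟩
  rw [Nat.add_sub_cancel]
  field_simp
  ring

theorem memBesov_one_iff {n : ℕ} (hn : 1 < n) (hc : HasRadiusOne c) (hi : i ∈ imagSphere)
    {f : ℍ[ℝ] → ℍ[ℝ]} (hf : SliceRegularOn f unitBall)
    (hcf : ∀ j ∈ imagSphere, ∀ z : ℂ, ‖z‖ < 1 → f (sliceMap j z) = sliceSeries j c z) :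
    MemBesov 1 n f ↔ sliceNorm n i (derivCoeff n c) < ⊤ := by
  constructor
  · rintro ⟨-, h⟩
    rw [← besovIntegral_one_eq hn hc hi (hcf i hi)]
    exact (le_iSup₂ (f := fun i (_ : i ∈ imagSphere) => besovIntegral 1 n f i) i hi).trans_lt h
  · intro h
    refine ⟨hf, lt_of_le_of_lt (iSup₂_le fun j hj => ?_)
      (ENNReal.mul_lt_top (by simp : (2 : ENNReal) < ⊤) h)⟩
    rw [besovIntegral_one_eq hn hc hj (hcf j hj)]
    exact (hc.derivCoeff n).sliceNorm_le n hi hj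

end Slices

/-! ### Integration against quaternion-valued measures -/

section VectorMeasure

variable {X : Type*} [MeasurableSpace X]

open ContinuousLinearMap

theorem integral_mul_left {μ : VectorMeasure X ℍ[ℝ]} {g : X → ℍ[ℝ]} (hg : Integrable g μ.variation)
    (p : ℍ[ℝ]) :
    μ.integral (fun x => p * g x) (ContinuousLinearMap.mul ℝ ℍ[ℝ])
      = p * μ.integral g (ContinuousLinearMap.mul ℝ ℍ[ℝ]) := by
  have h1 := VectorMeasure.integral_continuousLinearMap_comp (μ := μ)
    (B := ContinuousLinearMap.mul ℝ ℍ[ℝ]) (C := ContinuousLinearMap.mul ℝ ℍ[ℝ] p) hg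
  have h2 := VectorMeasure.continuousLinearMap_apply_integral (μ := μ)
    (B := ContinuousLinearMap.mul ℝ ℍ[ℝ]) (C := ContinuousLinearMap.mul ℝ ℍ[ℝ] p) hg
  simp only [ContinuousLinearMap.mul_apply'] at h1 h2
  rw [h1, h2]
  congr 1
  ext1 x
  ext1 y
  simp [mul_assoc]

/-- Clear for indicators, hence for simple functions; the bounded approximations of `g` converge
everywhere, and dominated convergence applies on both sides. The order of the product matters: the
density stands on the right. -/
theorem integral_withDensityᵥ {ρ : Measure X} {h : X → ℍ[ℝ]} (hh : Integrable h ρ)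
    {g : X → ℍ[ℝ]} (hg : StronglyMeasurable g) {C : ℝ} (hC : ∀ x, ‖g x‖ ≤ C) :
    (ρ.withDensityᵥ h).integral g (ContinuousLinearMap.mul ℝ ℍ[ℝ]) = ∫ x, g x * h x ∂ρ := by
  -- A point is needed to derive `0 ≤ C` from the bound.
  rcases isEmpty_or_nonempty X with hX | ⟨⟨x₀⟩⟩
  · rw [VectorMeasure.integral_of_isEmpty, integral_of_isEmpty]
  have hC0 : 0 ≤ C := (norm_nonneg _).trans (hC x₀)
  set μ := ρ.withDensityᵥ h with hμ
  have hfin : IsFiniteMeasure μ.variation := by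
    rw [hμ, Measure.variation_withDensityᵥ hh]
    exact ⟨by simpa using! hh.2⟩
  have hbdd : ∀ s : SimpleFunc X ℍ[ℝ], Integrable (fun x => s x * h x) ρ := by
    intro s
    obtain ⟨M, hM⟩ := s.exists_forall_norm_le
    exact hh.bdd_mul s.stronglyMeasurable.aestronglyMeasurable (Eventually.of_forall hM)
  have hsimple : ∀ s : SimpleFunc X ℍ[ℝ],
      μ.integral s (ContinuousLinearMap.mul ℝ ℍ[ℝ]) = ∫ x, s x * h x ∂ρ := by
    intro s
    induction s using SimpleFunc.induction with
    | const c hs =>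
      rename_i s
      have e1 : ⇑(SimpleFunc.piecewise s hs (SimpleFunc.const X c) (SimpleFunc.const X 0))
          = s.indicator (fun _ => c) := by
        ext1 x; by_cases hx : x ∈ s <;> simp [hx]
      rw [e1, VectorMeasure.integral_indicator_const _ hs, mul_apply', hμ,
        withDensityᵥ_apply hh hs, ← integral_indicator hs]
      have e2 : (fun x => s.indicator (fun _ => c) x * h x)
          = fun x => (ContinuousLinearMap.mul ℝ ℍ[ℝ] c) (s.indicator h x) := by
        ext1 x; by_cases hx : x ∈ s <;> simp [hx]
      rw [e2, ContinuousLinearMap.integral_comp_comm _ (hh.indicator hs)]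
      rfl
    | @add f g _ hf hg =>
      have i1 : ∀ s : SimpleFunc X ℍ[ℝ], Integrable s μ.variation := fun s =>
        SimpleFunc.integrable_of_isFiniteMeasure s
      rw [SimpleFunc.coe_add, VectorMeasure.integral_add (i1 f) (i1 g), hf, hg,
        ← integral_add (hbdd f) (hbdd g)]
      simp only [Pi.add_apply, add_mul]
  have hlim := fun x => hg.tendsto_approxBounded_of_norm_le (hC x)
  have t1 := VectorMeasure.tendsto_integral_of_dominated_convergence (μ := μ)
    (B := ContinuousLinearMap.mul ℝ ℍ[ℝ]) (fun _ => C)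
    (fun n => (hg.approxBounded C n).stronglyMeasurable.aestronglyMeasurable)
    (integrable_const C) (fun n => Eventually.of_forall fun x => hg.norm_approxBounded_le hC0 n x)
    (Eventually.of_forall hlim)
  have t2 := tendsto_integral_of_dominated_convergence (μ := ρ)
    (F := fun n x => hg.approxBounded C n x * h x) (fun x => C * ‖h x‖)
    (fun n => (hbdd _).aestronglyMeasurable) (hh.norm.const_mul C)
    (fun n => Eventually.of_forall fun x => by
      rw [norm_mul]
      exact mul_le_mul_of_nonneg_right (hg.norm_approxBounded_le hC0 n x) (norm_nonneg _))
    (Eventually.of_forall fun x => (hlim x).mul_const (h x))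
  simp_rw [hsimple] at t1
  exact tendsto_nhds_unique t1 t2

theorem variation_withDensityᵥ_univ_lt_top {ρ : Measure X} {h : X → ℍ[ℝ]} (hh : Integrable h ρ) :
    (ρ.withDensityᵥ h).variation Set.univ < ⊤ := by
  rw [Measure.variation_withDensityᵥ hh, withDensity_apply _ MeasurableSet.univ,
    Measure.restrict_univ]
  exact hh.2

end VectorMeasure

/-! ### From integrals and sums of Möbius transformations to the Besov space -/

section IntegralToBesov

variable {i : ℍ[ℝ]} {X : Type*} [MeasurableSpace X]

theorem enorm_mul_le_one : ‖ContinuousLinearMap.mul ℝ ℍ[ℝ]‖ₑ ≤ 1 := by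
  rw [← ofReal_norm, ← ENNReal.ofReal_one]
  exact ENNReal.ofReal_le_ofReal (ContinuousLinearMap.opNorm_mul_le ℝ ℍ[ℝ])

theorem stronglyMeasurable_sliceMap_comp (i : ℍ[ℝ]) {s : X → ℂ} (hs : Measurable s) :
    StronglyMeasurable fun x => sliceMap i (s x) :=
  (continuous_sliceMap i).comp_stronglyMeasurable hs.stronglyMeasurable

theorem hasSum_integral_sliceSeries (hi : i ∈ imagSphere) {μ : VectorMeasure X ℍ[ℝ]}
    [IsFiniteMeasure μ.variation] {s : ℕ → X → ℂ} (hs : ∀ m, Measurable (s m)) {b : ℕ → ℝ}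
    (hb : HasRadiusOne b) (hsb : ∀ m x, ‖s m x‖ ≤ b m) {z : ℂ} (hz : ‖z‖ < 1) :
    HasSum (fun m => sliceMap i (z ^ m) *
        μ.integral (fun x => sliceMap i (s m x)) (ContinuousLinearMap.mul ℝ ℍ[ℝ]))
      (μ.integral (fun x => sliceSeries i (fun m => sliceMap i (s m x)) z)
        (ContinuousLinearMap.mul ℝ ℍ[ℝ])) := by
  have hint : ∀ m, Integrable (fun x => sliceMap i (s m x)) μ.variation := fun m =>
    Integrable.of_bound (stronglyMeasurable_sliceMap_comp i (hs m)).aestronglyMeasurable (b m)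
      (Eventually.of_forall fun x => by rw [norm_sliceMap hi]; exact hsb m x)
  have hrad : ∀ x, HasRadiusOne fun m => sliceMap i (s m x) := fun x =>
    hb.mono fun m => by
      rw [norm_sliceMap hi]
      exact (hsb m x).trans (le_abs_self _)
  simp_rw [← integral_mul_left (hint _)]
  refine VectorMeasure.hasSum_integral_of_dominated_convergence (fun m _ => ‖b m‖ * ‖z‖ ^ m)
    (fun m => ((hint m).const_mul _).aestronglyMeasurable)
    (fun m => Eventually.of_forall fun x => ?_)
    (Eventually.of_forall fun x => hb _ (norm_nonneg _) hz) (integrable_const _)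
    (Eventually.of_forall fun x => (hrad x).hasSum hi hz)
  rw [norm_sliceMap_pow_mul hi, norm_sliceMap hi]
  gcongr
  exact (hsb m x).trans (le_abs_self _)

/-- The abstract parameter space `X` lets one argument serve (ii), with `X = ℕ`, and (iii), with `X
= 𝔹_i`. -/
theorem memBesov_one_of_eq_integral {n : ℕ} (hn : 1 < n) (hi : i ∈ imagSphere) {f : ℍ[ℝ] → ℍ[ℝ]}
    (hf : SliceRegularOn f unitBall) {μ : VectorMeasure X ℍ[ℝ]} (hμ : μ.variation Set.univ < ⊤)
    {α : X → ℂ} (hα : Measurable α) (hα1 : ∀ x, ‖α x‖ < 1) (γ : ℍ[ℝ])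
    (h : ∀ z : ℂ, ‖z‖ < 1 → f (sliceMap i z) = γ +
      μ.integral (fun x => moebius (sliceMap i (α x)) (sliceMap i z))
        (ContinuousLinearMap.mul ℝ ℍ[ℝ])) :
    MemBesov 1 n f := by
  have : IsFiniteMeasure μ.variation := ⟨hμ⟩
  obtain ⟨c, hc, hcf⟩ := hf.exists_coeff
  have hone : HasRadiusOne fun _ : ℕ => (1 : ℝ) := HasRadiusOne.of_norm_le (M := 1) (by simp)
  have hτ : ∀ m, Measurable fun x => moebCoeff (α x) m := fun m =>
    (continuous_moebCoeff m).measurable.comp hα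
  set I : ℕ → ℍ[ℝ] := fun m => μ.integral (fun x => sliceMap i (moebCoeff (α x) m))
    (ContinuousLinearMap.mul ℝ ℍ[ℝ]) with hI
  -- The constant `γ` only enters the coefficient of index `0`, so the derivative of order `n ≥ 1`
  -- does not see it.
  set e : ℕ → ℍ[ℝ] := fun m => (if m = 0 then γ else 0) + I m with he
  have hIsum := fun {z : ℂ} (hz : ‖z‖ < 1) => hasSum_integral_sliceSeries hi (μ := μ) hτ hone
    (fun m x => norm_moebCoeff_le (hα1 x) m) hz
  have hesum : ∀ z : ℂ, ‖z‖ < 1 → HasSum (fun m => sliceMap i (z ^ m) * e m) (f (sliceMap i z)) := by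
    intro z hz
    have h0 : HasSum (fun m => sliceMap i (z ^ m) * (if m = 0 then γ else 0)) γ := by
      have := hasSum_single (f := fun m => sliceMap i (z ^ m) * (if m = 0 then γ else 0)) 0
        fun m hm => by simp [hm]
      simpa using this
    rw [h z hz]
    simp_rw [moebius_sliceMap hi hi]
    simpa only [he, mul_add] using h0.add (hIsum hz)
  have hec : HasRadiusOne e := HasRadiusOne.of_summable hi fun z hz => (hesum z hz).summable
  have hce : c = e := funext fun m => by
    rw [hc.coeff_eq hi (hcf i hi), hec.coeff_eq hi fun z hz =>
      (hesum z hz).unique (hec.hasSum hi hz)]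
  rw [memBesov_one_iff hn hc hi hf hcf, hce]
  have hd : ∀ k, derivCoeff n e k = μ.integral
      (fun x => sliceMap i (derivCoeff n (moebCoeff (α x)) k)) (ContinuousLinearMap.mul ℝ ℍ[ℝ]) := by
    intro k
    simp only [derivCoeff, sliceMap_smul]
    rw [VectorMeasure.integral_fun_smul, he]
    simp only
    rw [if_neg (by omega), zero_add]
  have hdb := hone.derivCoeff n
  have hdsum := fun {z : ℂ} (hz : ‖z‖ < 1) => hasSum_integral_sliceSeries hi (μ := μ)
    (s := fun k x => derivCoeff n (moebCoeff (α x)) k) (fun k => (hτ (k + n)).const_smul ((k + n).descFactorial n : ℝ))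
    (b := derivCoeff n fun _ : ℕ => (1 : ℝ)) hdb
    (fun m x => by
      rw [derivCoeff, derivCoeff, norm_smul, Real.norm_of_nonneg (by positivity), smul_eq_mul]
      gcongr
      exact norm_moebCoeff_le (hα1 x) _) hz
  obtain ⟨C, hC, hCb⟩ := lintegral_one_sub_norm_div_cube_le
  set M : ℝ := n.factorial * 2 ^ n with hM
  have hM0 : 0 ≤ M := by positivity
  set F : ℂ → X → ENNReal := fun z x =>
    ENNReal.ofReal M * ENNReal.ofReal ((1 - ‖α x‖) / ‖1 - z * starRingEnd ℂ (α x)‖ ^ 3) with hF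
  have hFm : Measurable (Function.uncurry F) := by
    have h1 : Measurable fun p : ℂ × X => α p.2 := hα.comp measurable_snd
    have h2 : Measurable fun p : ℂ × X => starRingEnd ℂ (α p.2) :=
      Complex.continuous_conj.measurable.comp h1
    simp only [hF, Function.uncurry_def]
    exact ((measurable_const.sub h1.norm).div
      ((measurable_const.sub (measurable_fst.mul h2)).norm.pow_const 3)).ennreal_ofReal.const_mul _
  calc sliceNorm n i (derivCoeff n e)
      ≤ ∫⁻ z in Metric.ball (0 : ℂ) 1, ∫⁻ x, F z x ∂μ.variation := by
        refine setLIntegral_mono' measurableSet_ball fun z hz => ?_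
        have hz : ‖z‖ < 1 := by simpa using hz
        have hval : sliceSeries i (derivCoeff n e) z = μ.integral (fun x => sliceSeries i
            (fun k => sliceMap i (derivCoeff n (moebCoeff (α x)) k)) z)
            (ContinuousLinearMap.mul ℝ ℍ[ℝ]) := by
          rw [← (hdsum hz).tsum_eq, sliceSeries]
          simp_rw [hd]
        rw [hval]
        calc _ ≤ ENNReal.ofReal (besovWeight n z) * (1 * ∫⁻ x, ‖sliceSeries i
              (fun k => sliceMap i (derivCoeff n (moebCoeff (α x)) k)) z‖ₑ ∂μ.variation) := by
              gcongr
              exact (VectorMeasure.enorm_integral_le_lintegral_enorm).trans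
                (by gcongr; exact enorm_mul_le_one)
          _ = ∫⁻ x, ENNReal.ofReal (besovWeight n z) * ‖sliceSeries i
              (fun k => sliceMap i (derivCoeff n (moebCoeff (α x)) k)) z‖ₑ ∂μ.variation := by
              rw [one_mul, lintegral_const_mul' _ _ ENNReal.ofReal_ne_top]
          _ ≤ _ := by
              refine lintegral_mono fun x => ?_
              simp only [hF]
              rw [← ofReal_norm, ← ENNReal.ofReal_mul (besovWeight_nonneg n hz),
                ← ENNReal.ofReal_mul hM0]
              apply ENNReal.ofReal_le_ofReal
              refine le_trans ?_ (besovWeight_mul_kernel_le hn (hα1 x) hz)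
              exact mul_le_mul_of_nonneg_left (norm_sliceSeries_derivCoeff_moebCoeff_le hi
                (by omega) (hα1 x) hz) (besovWeight_nonneg n hz)
    -- After Tonelli the inner integral is bounded uniformly in `α x`, and the total variation is
    -- finite.
    _ = ∫⁻ x, (∫⁻ z in Metric.ball (0 : ℂ) 1, F z x) ∂μ.variation :=
        lintegral_lintegral_swap hFm.aemeasurable
    _ ≤ ∫⁻ _, ENNReal.ofReal M * C ∂μ.variation := by
        refine lintegral_mono fun x => ?_
        simp only [hF]
        rw [lintegral_const_mul' _ _ ENNReal.ofReal_ne_top]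
        gcongr
        exact hCb _ (hα1 x)
    _ < ⊤ := by
        rw [lintegral_const]
        exact ENNReal.mul_lt_top (ENNReal.mul_lt_top ENNReal.ofReal_lt_top hC) hμ

theorem exists_complex_of_sliceDisc (hi : i ∈ imagSphere) :
    ∃ α : sliceDisc i → ℂ, Continuous α ∧ (∀ x, ‖α x‖ < 1) ∧ ∀ x, sliceMap i (α x) = x := by
  choose α h1 h2 using fun x : sliceDisc i => (mem_sliceDisc hi).1 x.2
  refine ⟨α, ?_, h1, h2⟩
  have hiso : Isometry α := by
    refine Isometry.of_dist_eq fun x y => ?_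
    rw [Subtype.dist_eq, ← h2 x, ← h2 y, dist_eq_norm, dist_eq_norm, ← sliceMap_sub,
      norm_sliceMap hi]
  exact hiso.continuous

theorem memBesov_one_of_eq_integral_sliceDisc {n : ℕ} (hn : 1 < n) (hi : i ∈ imagSphere)
    {f : ℍ[ℝ] → ℍ[ℝ]} (hf : SliceRegularOn f unitBall) {μ : VectorMeasure (sliceDisc i) ℍ[ℝ]}
    (hμ : μ.variation Set.univ < ⊤)
    (h : ∀ q ∈ unitBall, f q = μ.integral (fun z => moebius (z : ℍ[ℝ]) q)
      (ContinuousLinearMap.mul ℝ ℍ[ℝ])) :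
    MemBesov 1 n f := by
  obtain ⟨α, hα, hα1, hα2⟩ := exists_complex_of_sliceDisc hi
  refine memBesov_one_of_eq_integral hn hi hf hμ hα.measurable hα1 0 fun z hz => ?_
  rw [zero_add, h _ ((sliceMap_mem_unitBall hi).2 hz)]
  simp_rw [hα2]

theorem norm_moebius_sliceMap_le (hi : i ∈ imagSphere) {j : ℍ[ℝ]} (hj : j ∈ imagSphere) {a z : ℂ}
    (ha : ‖a‖ < 1) (hz : ‖z‖ < 1) :
    ‖moebius (sliceMap i a) (sliceMap j z)‖ ≤ (1 - ‖z‖)⁻¹ := by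
  rw [moebius_sliceMap hi hj, ← tsum_geometric_of_lt_one (norm_nonneg _) hz]
  refine tsum_of_norm_bounded (summable_geometric_of_lt_one (norm_nonneg _) hz).hasSum fun m => ?_
  rw [norm_sliceMap_pow_mul hj, norm_sliceMap hi]
  exact mul_le_of_le_one_left (by positivity) (norm_moebCoeff_le ha m)

/-- The sum is the integral over `ℕ` against the vector measure with density `γ (k + 1)` for the
counting measure, finite because `γ` is summable. -/
theorem memBesov_one_of_hasSum {n : ℕ} (hn : 1 < n) (hi : i ∈ imagSphere)
    {f : ℍ[ℝ] → ℍ[ℝ]} (hf : SliceRegularOn f unitBall) {γ a : ℕ → ℍ[ℝ]} (hγ : Memℓp γ 1)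
    (ha : ∀ k, 1 ≤ k → a k ∈ sliceDisc i)
    (h : ∀ q ∈ unitBall, HasSum (fun k : ℕ => moebius (a (k + 1)) q * γ (k + 1)) (f q - γ 0)) :
    MemBesov 1 n f := by
  choose α hα1 hα2 using fun k : ℕ => (mem_sliceDisc hi).1 (ha (k + 1) (by omega))
  have hs : Summable fun k => ‖γ (k + 1)‖ := by
    have := hγ.summable (p := 1) (by simp)
    simp only [ENNReal.toReal_one, Real.rpow_one] at this
    exact (summable_nat_add_iff 1).2 this
  have hint : Integrable (fun k => γ (k + 1)) (Measure.count : Measure ℕ) :=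
    integrable_count_iff.2 hs
  refine memBesov_one_of_eq_integral hn hi hf (variation_withDensityᵥ_univ_lt_top hint)
    (measurable_from_nat (f := α)) hα1 (γ 0) fun z hz => ?_
  have hb := fun k => norm_moebius_sliceMap_le hi hi (hα1 k) hz
  have hsum := h _ ((sliceMap_mem_unitBall hi).2 hz)
  rw [integral_withDensityᵥ hint (StronglyMeasurable.of_discrete) hb]
  have hint2 : Integrable (fun k => moebius (sliceMap i (α k)) (sliceMap i z) * γ (k + 1))
      (Measure.count : Measure ℕ) :=
    hint.bdd_mul StronglyMeasurable.of_discrete.aestronglyMeasurable (Eventually.of_forall hb)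
  rw [integral_countable hint2]
  simp only [Measure.real, Measure.count_singleton, ENNReal.toReal_one, one_smul]
  simp_rw [hα2]
  rw [hsum.tsum_eq]
  abel

end IntegralToBesov

/-! ### Orthogonality under rotations, and Beta integrals -/

section Orthogonality

/-- The number `exp(√-1)` has distinct powers since `π` is irrational. One rotation then separates
all pairs of degrees. -/
theorem exists_unit_pow_injective :
    ∃ ζ : ℂ, ‖ζ‖ = 1 ∧ Function.Injective fun p : ℕ => ζ ^ p := by
  refine ⟨Complex.exp Complex.I, by simpa using Complex.norm_exp_ofReal_mul_I 1, fun p q h => ?_⟩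
  simp only [← Complex.exp_nat_mul] at h
  obtain ⟨k, hk⟩ := Complex.exp_eq_exp_iff_exists_int.1 h
  have h1 : ((p : ℝ) : ℂ) = ((q + k * (2 * Real.pi) : ℝ) : ℂ) := by
    push_cast
    have : Complex.I * (p : ℂ) = Complex.I * ((q : ℂ) + k * (2 * Real.pi)) := by
      rw [mul_comm, hk]; ring
    exact mul_left_cancel₀ Complex.I_ne_zero this
  have h2 : (p : ℝ) = q + k * (2 * Real.pi) := by exact_mod_cast h1
  rcases eq_or_ne k 0 with rfl | hk0
  · have : (p : ℝ) = q := by simpa using h2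
    exact_mod_cast this
  · exfalso
    refine irrational_pi ⟨((p : ℚ) - q) / (2 * k), ?_⟩
    have : (k : ℝ) ≠ 0 := by exact_mod_cast hk0
    push_cast
    rw [h2]
    field_simp
    ring

theorem setIntegral_ball_rotation {E : Type*} [NormedAddCommGroup E] [NormedSpace ℝ E]
    (F : ℂ → E) {ζ : ℂ} (hζ : ‖ζ‖ = 1) (R : ℝ) :
    ∫ z in Metric.ball (0 : ℂ) R, F (ζ * z) = ∫ z in Metric.ball (0 : ℂ) R, F z := by
  let c : Circle := ⟨ζ, by simpa [Submonoid.unitSphere] using hζ⟩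
  have hemb : MeasurableEmbedding (rotation c : ℂ → ℂ) :=
    (rotation c).toHomeomorph.measurableEmbedding
  rw [← (rotation c).measurePreserving.setIntegral_preimage_emb hemb F (Metric.ball (0 : ℂ) R)]
  have hpre : (rotation c : ℂ → ℂ) ⁻¹' Metric.ball 0 R = Metric.ball 0 R := by
    ext z
    rw [Set.mem_preimage, mem_ball_zero_iff, mem_ball_zero_iff, LinearIsometryEquiv.norm_map]
  rw [hpre]
  rfl

/-- `Φ` is multiplied by `ζᵇ⁻ᵖ` under the rotation by `ζ`. -/
def RotHomogeneous (p b : ℕ) (Φ : ℂ → ℂ) : Prop :=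
  ∀ ζ z : ℂ, ‖ζ‖ = 1 → ζ ^ p * Φ (ζ * z) = ζ ^ b * Φ z

theorem RotHomogeneous.mul {p b p' b' : ℕ} {Φ Ψ : ℂ → ℂ} (h : RotHomogeneous p b Φ)
    (h' : RotHomogeneous p' b' Ψ) : RotHomogeneous (p + p') (b + b') fun z => Φ z * Ψ z := by
  intro ζ z hζ
  rw [pow_add, mul_mul_mul_comm, h ζ z hζ, h' ζ z hζ, pow_add]
  ring

theorem rotHomogeneous_pow (k : ℕ) : RotHomogeneous 0 k fun z => z ^ k := by
  intro ζ z _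
  simp only
  rw [mul_pow, pow_zero, one_mul]

theorem mul_conj_of_norm_eq_one {ζ : ℂ} (hζ : ‖ζ‖ = 1) : ζ * starRingEnd ℂ ζ = 1 := by
  rw [Complex.mul_conj, Complex.normSq_eq_norm_sq, hζ]
  simp

theorem rotHomogeneous_moebCoeff (m : ℕ) : RotHomogeneous m 1 fun z => moebCoeff z m := by
  intro ζ z hζ
  cases m with
  | zero => simp [moebCoeff]
  | succ m =>
    simp only [moebCoeff, map_mul, norm_mul, hζ, one_mul, pow_one, mul_pow, pow_succ ζ m]
    have : ζ ^ m * (starRingEnd ℂ ζ) ^ m = 1 := by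
      rw [← mul_pow, mul_conj_of_norm_eq_one hζ, one_pow]
    linear_combination ζ * (starRingEnd ℂ z) ^ m * (((‖z‖ ^ 2 - 1 : ℝ)) : ℂ) * this

theorem RotHomogeneous.conj {p b : ℕ} {Φ : ℂ → ℂ} (h : RotHomogeneous p b Φ) :
    RotHomogeneous b p fun z => starRingEnd ℂ (Φ z) := by
  intro ζ z hζ
  have h1 := congrArg (starRingEnd ℂ) (h ζ z hζ)
  simp only [map_mul, map_pow] at h1
  have e : ∀ k : ℕ, ζ ^ k * (starRingEnd ℂ ζ) ^ k = 1 := fun k => by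
    rw [← mul_pow, mul_conj_of_norm_eq_one hζ, one_pow]
  linear_combination (ζ ^ b * ζ ^ p) * h1 + ζ ^ p * starRingEnd ℂ (Φ z) * e b
    - ζ ^ b * starRingEnd ℂ (Φ (ζ * z)) * e p

/-- The disc is invariant under rotation by `ζ`, so `ζᵖ` and `ζᵇ` multiply the integral to the same
value, while `ζᵖ ≠ ζᵇ`. -/
theorem RotHomogeneous.setIntegral_eq_zero {p b : ℕ} {Φ : ℂ → ℂ} (h : RotHomogeneous p b Φ)
    (hpb : p ≠ b) (R : ℝ) : ∫ z in Metric.ball (0 : ℂ) R, Φ z = 0 := by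
  obtain ⟨ζ, hζ, hinj⟩ := exists_unit_pow_injective
  have h1 : ζ ^ p * ∫ z in Metric.ball (0 : ℂ) R, Φ z
      = ζ ^ b * ∫ z in Metric.ball (0 : ℂ) R, Φ z := by
    nth_rewrite 1 [← setIntegral_ball_rotation Φ hζ R]
    rw [← integral_const_mul, ← integral_const_mul]
    simp_rw [h ζ _ hζ]
  have h2 : (ζ ^ p - ζ ^ b) * ∫ z in Metric.ball (0 : ℂ) R, Φ z = 0 := by
    rw [sub_mul, h1, sub_self]
  exact (mul_eq_zero.1 h2).resolve_left (sub_ne_zero.2 fun e => hpb (hinj e))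

/-- Splitting off one factor `1 - r²` lowers `b` but produces a term with `a + 1`, so the induction
on `b` must run for all `a` at once. -/
theorem integral_pow_mul_one_sub_sq_pow (b : ℕ) : ∀ a : ℕ,
    ∫ r in (0 : ℝ)..1, r ^ (2 * a + 1) * (1 - r ^ 2) ^ b
      = (a.factorial * b.factorial : ℝ) / (2 * (a + b + 1).factorial) := by
  induction b with
  | zero =>
    intro a
    simp only [pow_zero, mul_one, integral_pow]
    rw [add_zero, Nat.factorial_succ]
    push_cast
    have : (a.factorial : ℝ) ≠ 0 := by positivity
    field_simp
    simp
    ring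
  | succ b ih =>
    intro a
    have h : ∀ r : ℝ, r ^ (2 * a + 1) * (1 - r ^ 2) ^ (b + 1)
        = r ^ (2 * a + 1) * (1 - r ^ 2) ^ b - r ^ (2 * (a + 1) + 1) * (1 - r ^ 2) ^ b := by
      intro r; ring
    simp_rw [h]
    rw [intervalIntegral.integral_sub (Continuous.intervalIntegrable (by fun_prop) _ _)
      (Continuous.intervalIntegrable (by fun_prop) _ _), ih, ih,
      show a + 1 + b + 1 = (a + b + 1) + 1 by ring, show a + (b + 1) + 1 = (a + b + 1) + 1 by ring,
      Nat.factorial_succ (a + b + 1), Nat.factorial_succ a, Nat.factorial_succ b]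
    push_cast
    field_simp
    ring

theorem setIntegral_ball_norm_pow_mul (a b : ℕ) :
    ∫ z in Metric.ball (0 : ℂ) 1, ‖z‖ ^ (2 * a) * (1 - ‖z‖ ^ 2) ^ b
      = Real.pi * (a.factorial * b.factorial : ℝ) / (a + b + 1).factorial := by
  set g : ℝ → ℝ := (Set.Iio 1).indicator fun r => r ^ (2 * a) * (1 - r ^ 2) ^ b with hg
  have h1 : ∫ z in Metric.ball (0 : ℂ) 1, ‖z‖ ^ (2 * a) * (1 - ‖z‖ ^ 2) ^ b = ∫ z : ℂ, g ‖z‖ := by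
    rw [← integral_indicator measurableSet_ball]
    congr 1
    funext z
    by_cases hz : ‖z‖ < 1
    · rw [Set.indicator_of_mem (by simpa using hz), hg, Set.indicator_of_mem (by simpa using hz)]
    · rw [Set.indicator_of_notMem (by simpa using hz), hg,
        Set.indicator_of_notMem (by simpa using hz)]
  have h2 : ∫ y in Set.Ioi (0 : ℝ), y ^ (2 - 1) • g y
      = ∫ r in (0 : ℝ)..1, r ^ (2 * a + 1) * (1 - r ^ 2) ^ b := by
    rw [intervalIntegral.integral_of_le zero_le_one, integral_Ioc_eq_integral_Ioo,
      ← Set.Ioi_inter_Iio, ← setIntegral_indicator measurableSet_Iio]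
    congr 1
    funext r
    by_cases hr : r ∈ Set.Iio (1 : ℝ)
    · rw [hg, Set.indicator_of_mem hr, Set.indicator_of_mem hr]
      simp; ring
    · rw [hg, Set.indicator_of_notMem hr, Set.indicator_of_notMem hr, smul_zero]
  rw [h1, integral_fun_norm_addHaar, Complex.finrank_real_complex, h2,
    integral_pow_mul_one_sub_sq_pow]
  have : (volume : Measure ℂ).real (Metric.ball 0 1) = Real.pi := by
    simp [Measure.real, Complex.volume_ball]
  rw [this]
  simp
  field_simp

end Orthogonality

/-! ### A biorthogonal system for the Möbius coefficients -/

section Dual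

/-- The squared `L²` norm of the coefficient function `z ↦ moebCoeff z m` on the unit disc. -/
def moebNormSq (m : ℕ) : ℝ := ∫ z in Metric.ball (0 : ℂ) 1, ‖moebCoeff z m‖ ^ 2

/-- The exact values are `π/2` for `m = 0` and `2π / ((l+1)(l+2)(l+3))` for `m = l + 1`. This cubic
decay is the origin of the weight `(m + 1)³` used from here on. -/
theorem one_le_moebNormSq_mul (m : ℕ) : 1 ≤ moebNormSq m * ((m : ℝ) + 1) ^ 3 := by
  have hpi := Real.pi_gt_three
  cases m with
  | zero =>
    have h := setIntegral_ball_norm_pow_mul 1 0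
    simp only [mul_one, pow_zero] at h
    rw [moebNormSq]
    simp only [moebCoeff]
    rw [h]
    norm_num [Nat.factorial]
    linarith
  | succ l =>
    have h := setIntegral_ball_norm_pow_mul l 2
    have e : ∀ z : ℂ, ‖moebCoeff z (l + 1)‖ ^ 2 = ‖z‖ ^ (2 * l) * (1 - ‖z‖ ^ 2) ^ 2 := by
      intro z
      rw [norm_moebCoeff_succ, mul_pow, sq_abs, ← pow_mul, mul_comm l 2]
      ring
    rw [moebNormSq]
    simp_rw [e]
    rw [h, show l + 2 + 1 = l + 3 by ring, Nat.factorial_succ (l + 2), Nat.factorial_succ (l + 1),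
      Nat.factorial_succ l]
    push_cast
    have hl : (l.factorial : ℝ) ≠ 0 := by positivity
    rw [div_mul_eq_mul_div, le_div_iff₀ (by positivity)]
    have hl0 : (0 : ℝ) < l.factorial := by positivity
    have hl1 : (0 : ℝ) ≤ l := by positivity
    norm_num [Nat.factorial]
    have key : ((l : ℝ) + 2 + 1) * ((l + 1 + 1) * ((l + 1))) ≤ 6 * (l + 1 + 1) ^ 3 := by
      nlinarith [mul_nonneg hl1 hl1, mul_nonneg hl1 (mul_nonneg hl1 hl1)]
    calc ((l : ℝ) + 2 + 1) * ((l + 1 + 1) * ((l + 1) * l.factorial))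
        = (((l : ℝ) + 2 + 1) * ((l + 1 + 1) * ((l + 1)))) * l.factorial := by ring
      _ ≤ 6 * (l + 1 + 1) ^ 3 * l.factorial := by gcongr
      _ ≤ (2 * Real.pi) * (l + 1 + 1) ^ 3 * l.factorial := by gcongr; linarith
      _ = _ := by ring

theorem moebNormSq_pos (m : ℕ) : 0 < moebNormSq m := by
  have h := one_le_moebNormSq_mul m
  by_contra h0
  have : moebNormSq m * ((m : ℝ) + 1) ^ 3 ≤ 0 :=
    mul_nonpos_of_nonpos_of_nonneg (not_lt.1 h0) (by positivity)
  linarith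

/-- A system biorthogonal to the coefficient functions `z ↦ moebCoeff z m` in `L²` of the disc. -/
def moebDual (m : ℕ) (z : ℂ) : ℂ := ((moebNormSq m)⁻¹ : ℝ) * starRingEnd ℂ (moebCoeff z m)

theorem continuous_moebDual (m : ℕ) : Continuous (moebDual m) :=
  continuous_const.mul (Complex.continuous_conj.comp (continuous_moebCoeff m))

theorem norm_moebDual_le (m : ℕ) {z : ℂ} (hz : ‖z‖ < 1) : ‖moebDual m z‖ ≤ ((m : ℝ) + 1) ^ 3 := by
  have h0 := moebNormSq_pos m
  rw [moebDual, norm_mul, RCLike.norm_conj, Complex.norm_real, Real.norm_of_nonneg (by positivity)]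
  refine (mul_le_of_le_one_right (by positivity) (norm_moebCoeff_le hz m)).trans ?_
  rw [inv_le_iff_one_le_mul₀ h0, mul_comm]
  exact one_le_moebNormSq_mul m

/-- Distinct coefficient functions have distinct rotation degrees `1 - m`, hence are orthogonal; the
diagonal is normalised by definition. -/
theorem setIntegral_moebCoeff_mul_moebDual (l m : ℕ) :
    ∫ z in Metric.ball (0 : ℂ) 1, moebCoeff z l * moebDual m z = if l = m then 1 else 0 := by
  have e : ∀ z, moebCoeff z l * moebDual m z
      = ((moebNormSq m)⁻¹ : ℝ) * (moebCoeff z l * starRingEnd ℂ (moebCoeff z m)) := by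
    intro z; rw [moebDual]; ring
  simp_rw [e]
  rw [integral_const_mul]
  split_ifs with h
  · subst h
    have e2 : ∀ z, moebCoeff z l * starRingEnd ℂ (moebCoeff z l)
        = ((‖moebCoeff z l‖ ^ 2 : ℝ) : ℂ) := by
      intro z; rw [Complex.mul_conj, Complex.normSq_eq_norm_sq]
    simp_rw [e2]
    rw [integral_complex_ofReal, ← moebNormSq, ← Complex.ofReal_mul, inv_mul_cancel₀ (moebNormSq_pos l).ne']
    simp
  · rw [((rotHomogeneous_moebCoeff l).mul (rotHomogeneous_moebCoeff m).conj).setIntegral_eq_zero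
      (by omega), mul_zero]

end Dual

/-! ### Rapidly decaying coefficients as moments of a bounded function -/

section Representation

variable {i : ℍ[ℝ]}

/-- Integration over the disc of functions with values in the slice `ℂ(i)`. -/
theorem integral_sliceMap_mul {ν : Measure ℂ} {F : ℂ → ℂ} (hF : Integrable F ν) (q : ℍ[ℝ]) :
    ∫ z, sliceMap i (F z) * q ∂ν = sliceMap i (∫ z, F z ∂ν) * q := by
  have := (((ContinuousLinearMap.mul ℝ ℍ[ℝ]).flip q).comp (sliceCLM i)).integral_comp_comm hF
  simpa using this

theorem integrable_sliceMap_mul {ν : Measure ℂ} {F : ℂ → ℂ} (hF : Integrable F ν) (q : ℍ[ℝ]) :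
    Integrable (fun z => sliceMap i (F z) * q) ν :=
  (((ContinuousLinearMap.mul ℝ ℍ[ℝ]).flip q).comp (sliceCLM i)).integrable_comp hF

instance isFiniteMeasure_restrict_ball (R : ℝ) :
    IsFiniteMeasure ((volume : Measure ℂ).restrict (Metric.ball 0 R)) :=
  ⟨by
    rw [Measure.restrict_apply_univ]
    exact measure_ball_lt_top⟩

/-- The function is `∑ₘ moebDual m · cₘ`; the weight `(m + 1)³` bounds the dual functions and makes
the series converge uniformly. The explicit sup bound is what makes the error halve in the atomic
approximation. -/
theorem exists_integral_moebCoeff_eq_of_summable (hi : i ∈ imagSphere) {c : ℕ → ℍ[ℝ]}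
    (hc : Summable fun m : ℕ => ((m : ℝ) + 1) ^ 3 * ‖c m‖) :
    ∃ h : ℂ → ℍ[ℝ], IntegrableOn h (Metric.ball 0 1) ∧
      (∀ z, ‖z‖ < 1 → ‖h z‖ ≤ ∑' m : ℕ, ((m : ℝ) + 1) ^ 3 * ‖c m‖) ∧
      ∀ m, ∫ z in Metric.ball (0 : ℂ) 1, sliceMap i (moebCoeff z m) * h z = c m := by
  have hbd : ∀ m z, ‖z‖ < 1 → ‖sliceMap i (moebDual m z) * c m‖ ≤ ((m : ℝ) + 1) ^ 3 * ‖c m‖ := by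
    intro m z hz
    rw [norm_mul, norm_sliceMap hi]
    gcongr
    exact norm_moebDual_le m hz
  set h : ℂ → ℍ[ℝ] := fun z => ∑' m : ℕ, sliceMap i (moebDual m z) * c m with hh
  have hcont : ContinuousOn h (Metric.ball 0 1) := by
    refine continuousOn_tsum (fun m => ?_) hc fun m z hz => hbd m z (by simpa using hz)
    exact (((continuous_sliceMap i).comp (continuous_moebDual m)).mul
      continuous_const).continuousOn
  have hle : ∀ z, ‖z‖ < 1 → ‖h z‖ ≤ ∑' m : ℕ, ((m : ℝ) + 1) ^ 3 * ‖c m‖ := fun z hz =>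
    tsum_of_norm_bounded hc.hasSum fun m => hbd m z hz
  refine ⟨h, ?_, hle, fun l => ?_⟩
  · refine Integrable.of_bound (hcont.aestronglyMeasurable measurableSet_ball) _
      (ae_restrict_of_forall_mem measurableSet_ball fun z hz => hle z (by simpa using hz))
  · have hint : ∀ m, Integrable (fun z => moebCoeff z l * moebDual m z)
        (volume.restrict (Metric.ball 0 1)) := by
      intro m
      refine Integrable.of_bound ((continuous_moebCoeff l).mul
        (continuous_moebDual m)).aestronglyMeasurable (((m : ℝ) + 1) ^ 3)
        (ae_restrict_of_forall_mem measurableSet_ball fun z hz => ?_)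
      have hz : ‖z‖ < 1 := by simpa using hz
      rw [norm_mul]
      exact (mul_le_of_le_one_left (norm_nonneg _) (norm_moebCoeff_le hz l)).trans
        (norm_moebDual_le m hz)
    have hterm : ∀ m, ∫ z in Metric.ball (0 : ℂ) 1, sliceMap i (moebCoeff z l * moebDual m z) * c m
        = if m = l then c l else 0 := by
      intro m
      rw [integral_sliceMap_mul (hint m), setIntegral_moebCoeff_mul_moebDual]
      rcases eq_or_ne m l with rfl | hml
      · simp
      · simp [hml, hml.symm]
    have hs := hasSum_integral_of_summable_integral_norm
      (μ := volume.restrict (Metric.ball (0 : ℂ) 1))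
      (F := fun m z => sliceMap i (moebCoeff z l * moebDual m z) * c m)
      (fun m => integrable_sliceMap_mul (hint m) (c m)) ?_
    · simp_rw [hterm] at hs
      have h1 := hs.unique (hasSum_ite_eq l (c l))
      rw [← h1]
      refine setIntegral_congr_fun measurableSet_ball fun z hz => ?_
      have hz : ‖z‖ < 1 := by simpa using hz
      simp only [hh]
      rw [← (Summable.of_norm_bounded hc fun m => hbd m z hz).tsum_mul_left]
      simp_rw [sliceMap_mul hi, mul_assoc]
    · refine Summable.of_nonneg_of_le (fun m => by positivity) (fun m => ?_)
        (hc.mul_right (volume.real (Metric.ball (0 : ℂ) 1)))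
      rw [← smul_eq_mul, smul_eq_mul, mul_comm, ← smul_eq_mul, ← setIntegral_const]
      refine setIntegral_mono_on (integrable_sliceMap_mul (hint m) (c m)).norm
        (integrable_const _) measurableSet_ball fun z hz => ?_
      have hz : ‖z‖ < 1 := by simpa using hz
      rw [sliceMap_mul hi, mul_assoc, norm_mul, norm_sliceMap hi]
      exact (mul_le_of_le_one_left (norm_nonneg _) (norm_moebCoeff_le hz l)).trans (hbd m z hz)

end Representation

/-! ### The reproducing formula for Besov functions -/

section Reproducing

variable {i : ℍ[ℝ]}

theorem iUnion_ball_one : ⋃ k : ℕ, Metric.ball (0 : ℂ) (1 - 1 / ((k : ℝ) + 1)) = Metric.ball 0 1 := by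
  ext z
  simp only [Set.mem_iUnion, mem_ball_zero_iff]
  constructor
  · rintro ⟨k, hk⟩
    have : (0 : ℝ) < 1 / ((k : ℝ) + 1) := by positivity
    linarith
  · intro h
    obtain ⟨k, hk⟩ := exists_nat_one_div_lt (sub_pos.2 h)
    exact ⟨k, by linarith⟩

theorem tendsto_setIntegral_ball_one {E : Type*} [NormedAddCommGroup E] [NormedSpace ℝ E]
    {F : ℂ → E} (hF : IntegrableOn F (Metric.ball 0 1)) :
    Tendsto (fun k : ℕ => ∫ z in Metric.ball (0 : ℂ) (1 - 1 / ((k : ℝ) + 1)), F z) atTop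
      (𝓝 (∫ z in Metric.ball (0 : ℂ) 1, F z)) := by
  have := tendsto_setIntegral_of_monotone (μ := volume) (f := F)
    (s := fun k : ℕ => Metric.ball (0 : ℂ) (1 - 1 / ((k : ℝ) + 1)))
    (fun k => measurableSet_ball) (fun k l hkl => Metric.ball_subset_ball (by gcongr))
    (by rwa [iUnion_ball_one])
  rwa [iUnion_ball_one] at this

/-- Pairing with a function of rotation degree `b - p` selects the power `zᵖ⁻ᵇ`. Only integrability
of the whole product is known on the full disc, so the series is integrated term by term on balls of
radius `R < 1` before letting `R` tend to `1`. -/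
theorem RotHomogeneous.setIntegral_mul_sliceSeries (hi : i ∈ imagSphere) {d : ℕ → ℍ[ℝ]}
    (hd : HasRadiusOne d) {p b : ℕ} {Φ : ℂ → ℂ} (hΦ : RotHomogeneous p b Φ) (hΦm : Measurable Φ)
    {M : ℝ} (hΦb : ∀ z, ‖z‖ < 1 → ‖Φ z‖ ≤ M)
    (hint : IntegrableOn (fun z => sliceMap i (Φ z) * sliceSeries i d z) (Metric.ball 0 1)) :
    ∫ z in Metric.ball (0 : ℂ) 1, sliceMap i (Φ z) * sliceSeries i d z
      = if b ≤ p then sliceMap i (∫ z in Metric.ball (0 : ℂ) 1, Φ z * z ^ (p - b)) * d (p - b)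
        else 0 := by
  have hM : 0 ≤ M := (norm_nonneg _).trans (hΦb 0 (by simp))
  have hΦk : ∀ k : ℕ, ∀ R ≤ (1 : ℝ), IntegrableOn (fun z => Φ z * z ^ k) (Metric.ball 0 R) := by
    intro k R hR
    refine Integrable.of_bound (hΦm.mul (measurable_id.pow_const k)).aestronglyMeasurable M
      (ae_restrict_of_forall_mem measurableSet_ball fun z hz => ?_)
    have hz : ‖z‖ < 1 := (mem_ball_zero_iff.1 hz).trans_le hR
    rw [norm_mul, norm_pow]
    exact (mul_le_of_le_one_right (norm_nonneg _) (pow_le_one₀ (norm_nonneg _) hz.le)).trans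
      (hΦb z hz)
  have hball : ∀ R : ℝ, 0 ≤ R → R < 1 →
      ∫ z in Metric.ball (0 : ℂ) R, sliceMap i (Φ z) * sliceSeries i d z
      = if b ≤ p then sliceMap i (∫ z in Metric.ball (0 : ℂ) R, Φ z * z ^ (p - b)) * d (p - b)
        else 0 := by
    intro R hR0 hR
    have hs := hasSum_integral_of_summable_integral_norm
      (μ := volume.restrict (Metric.ball (0 : ℂ) R))
      (F := fun k z => sliceMap i (Φ z * z ^ k) * d k)
      (fun k => integrable_sliceMap_mul (hΦk k R hR.le) (d k)) ?_
    · have hterm : ∀ k, ∫ z in Metric.ball (0 : ℂ) R, sliceMap i (Φ z * z ^ k) * d k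
          = if p = b + k then sliceMap i (∫ z in Metric.ball (0 : ℂ) R, Φ z * z ^ k) * d k
            else 0 := by
        intro k
        rw [integral_sliceMap_mul (hΦk k R hR.le)]
        split_ifs with h
        · rfl
        · rw [(hΦ.mul (rotHomogeneous_pow k)).setIntegral_eq_zero (by omega), sliceMap_zero,
            zero_mul]
      simp_rw [hterm] at hs
      have e : ∫ z in Metric.ball (0 : ℂ) R, sliceMap i (Φ z) * sliceSeries i d z
          = ∫ z in Metric.ball (0 : ℂ) R, ∑' k, sliceMap i (Φ z * z ^ k) * d k := by
        refine setIntegral_congr_fun measurableSet_ball fun z hz => ?_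
        have hz : ‖z‖ < 1 := (mem_ball_zero_iff.1 hz).trans hR
        simp only [sliceSeries]
        rw [← (hd.hasSum hi hz).summable.tsum_mul_left]
        simp_rw [sliceMap_mul hi, mul_assoc]
      rw [e, ← hs.tsum_eq]
      split_ifs with h
      · rw [tsum_eq_single (p - b) fun k hk => if_neg (by omega), if_pos (by omega)]
      · exact (tsum_congr fun k => if_neg (by omega)).trans tsum_zero
    · refine Summable.of_nonneg_of_le (fun k => by positivity) (fun k => ?_)
        (((hd R hR0 hR).mul_left M).mul_right (volume.real (Metric.ball (0 : ℂ) R)))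
      rw [mul_comm _ (volume.real _), ← smul_eq_mul, ← setIntegral_const]
      refine setIntegral_mono_on (integrable_sliceMap_mul (hΦk k R hR.le) (d k)).norm
        (integrable_const _) measurableSet_ball fun z hz => ?_
      have hzR : ‖z‖ < R := mem_ball_zero_iff.1 hz
      rw [norm_mul, norm_sliceMap hi, norm_mul, norm_pow, mul_assoc, mul_comm (‖z‖ ^ k)]
      gcongr
      exact hΦb z (hzR.trans hR)
  have t1 := tendsto_setIntegral_ball_one hint
  have hk0 : ∀ k : ℕ, (0 : ℝ) ≤ 1 - 1 / ((k : ℝ) + 1) := fun k => by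
    rw [sub_nonneg, div_le_one (by positivity)]
    linarith [k.cast_nonneg (α := ℝ)]
  have hk1 : ∀ k : ℕ, (1 : ℝ) - 1 / ((k : ℝ) + 1) < 1 := fun k => by
    have : (0 : ℝ) < 1 / ((k : ℝ) + 1) := by positivity
    linarith
  simp_rw [hball _ (hk0 _) (hk1 _)] at t1
  refine tendsto_nhds_unique t1 ?_
  split_ifs with h
  · exact (((continuous_sliceMap i).tendsto _).comp
      (tendsto_setIntegral_ball_one (hΦk (p - b) 1 le_rfl))).mul_const _
  · exact tendsto_const_nhds

/-- The unimodular function `(z / |z|)ᵐ`. -/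
def unimodular (m : ℕ) (z : ℂ) : ℂ := (z / ‖z‖) ^ m

theorem measurable_unimodular (m : ℕ) : Measurable (unimodular m) :=
  (measurable_id.div (Complex.measurable_ofReal.comp measurable_norm)).pow_const m

theorem norm_unimodular_le (m : ℕ) (z : ℂ) : ‖unimodular m z‖ ≤ 1 := by
  rw [unimodular, norm_pow, norm_div, Complex.norm_real, norm_norm]
  exact pow_le_one₀ (by positivity) (div_self_le_one _)

theorem rotHomogeneous_unimodular (m : ℕ) : RotHomogeneous 0 m (unimodular m) := by
  intro ζ z hζ
  rw [unimodular, unimodular, norm_mul, hζ, one_mul, pow_zero, one_mul, mul_div_assoc, mul_pow]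

theorem conj_mul_div_norm (z : ℂ) : starRingEnd ℂ z * (z / ‖z‖) = ‖z‖ := by
  rcases eq_or_ne z 0 with rfl | h
  · simp
  · rw [← mul_div_assoc, mul_comm, Complex.mul_conj, Complex.normSq_eq_norm_sq]
    have : (‖z‖ : ℂ) ≠ 0 := by exact_mod_cast (norm_ne_zero_iff.2 h)
    push_cast
    field_simp

theorem rotHomogeneous_besovWeight (n : ℕ) : RotHomogeneous 0 0 fun z => (besovWeight n z : ℂ) := by
  intro ζ z hζ
  simp only [besovWeight, norm_mul, hζ, one_mul]

theorem besovWeight_le_one (n : ℕ) {z : ℂ} (hz : ‖z‖ < 1) : besovWeight n z ≤ 1 := by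
  have h0 : 0 ≤ 1 - ‖z‖ ^ 2 := by nlinarith [norm_nonneg z]
  unfold besovWeight
  rw [div_le_one Real.pi_pos]
  exact (pow_le_one₀ h0 (by nlinarith [norm_nonneg z])).trans (by linarith [Real.pi_gt_three])

/-- Division of a power series by a power of the variable keeps its weighted norm finite. -/
theorem sliceNorm_shift_lt_top (hi : i ∈ imagSphere) {g : ℕ → ℍ[ℝ]} (hg : HasRadiusOne g) (n p : ℕ)
    (h : sliceNorm n i g < ⊤) : sliceNorm n i (fun k => g (k + p)) < ⊤ := by
  have hG : HasRadiusOne fun k => g (k + p) := hg.shift 0 p (by simp)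
  set A : ℝ := ∑ k ∈ Finset.range p, ‖g k‖ with hA
  set A' : ℝ := ∑' k, ‖g (k + p)‖ * (1 / 2) ^ k with hA'
  have hA0 : 0 ≤ A := Finset.sum_nonneg fun k _ => norm_nonneg _
  have hA0' : 0 ≤ A' := tsum_nonneg fun k => by positivity
  have hpt : ∀ z : ℂ, ‖z‖ < 1 → ‖sliceSeries i (fun k => g (k + p)) z‖
      ≤ 2 ^ p * ‖sliceSeries i g z‖ + (2 ^ p * A + A') := by
    intro z hz
    -- Near the origin the shifted series is bounded; away from it, dividing by `zᵖ` costs at most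
    -- `2ᵖ` once the first `p` terms are subtracted.
    rcases lt_or_ge ‖z‖ (1 / 2) with h2 | h2
    · have : ‖sliceSeries i (fun k => g (k + p)) z‖ ≤ A' := by
        refine tsum_of_norm_bounded (hG (1 / 2) (by norm_num) (by norm_num)).hasSum fun k => ?_
        rw [norm_sliceMap_pow_mul hi]
        gcongr
      have : 0 ≤ 2 ^ p * ‖sliceSeries i g z‖ + 2 ^ p * A := by positivity
      linarith
    · have e : sliceSeries i g z = ∑ k ∈ Finset.range p, sliceMap i (z ^ k) * g k
          + sliceMap i (z ^ p) * sliceSeries i (fun k => g (k + p)) z := by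
        rw [sliceSeries, ← (hg.hasSum hi hz).summable.sum_add_tsum_nat_add p, sliceSeries,
          ← (hG.hasSum hi hz).summable.tsum_mul_left]
        congr 1
        refine tsum_congr fun k => ?_
        rw [← mul_assoc, ← sliceMap_mul hi, ← pow_add, add_comm p k]
      have h3 : ‖z‖ ^ p * ‖sliceSeries i (fun k => g (k + p)) z‖ ≤ ‖sliceSeries i g z‖ + A := by
        rw [← norm_pow, ← norm_sliceMap hi, ← norm_mul, ← sub_eq_of_eq_add' e]
        refine (norm_sub_le _ _).trans ?_
        gcongr
        refine (norm_sum_le _ _).trans (Finset.sum_le_sum fun k _ => ?_)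
        rw [norm_sliceMap_pow_mul hi]
        exact mul_le_of_le_one_right (norm_nonneg _) (pow_le_one₀ (norm_nonneg _) hz.le)
      have h4 : (1 / 2 : ℝ) ^ p * ‖sliceSeries i (fun k => g (k + p)) z‖
          ≤ ‖z‖ ^ p * ‖sliceSeries i (fun k => g (k + p)) z‖ := by gcongr
      have h5 : ‖sliceSeries i (fun k => g (k + p)) z‖
          = 2 ^ p * ((1 / 2 : ℝ) ^ p * ‖sliceSeries i (fun k => g (k + p)) z‖) := by
        rw [← mul_assoc, ← mul_pow]; norm_num
      rw [h5]
      have h6 : 2 ^ p * ((1 / 2 : ℝ) ^ p * ‖sliceSeries i (fun k => g (k + p)) z‖)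
          ≤ 2 ^ p * (‖sliceSeries i g z‖ + A) := by
        gcongr
        exact h4.trans h3
      linarith
  calc sliceNorm n i (fun k => g (k + p))
      ≤ ∫⁻ z in Metric.ball (0 : ℂ) 1, (ENNReal.ofReal (2 ^ p) *
          (ENNReal.ofReal (besovWeight n z) * ‖sliceSeries i g z‖ₑ)
          + ENNReal.ofReal (2 ^ p * A + A')) := by
        refine setLIntegral_mono' measurableSet_ball fun z hz => ?_
        have hz : ‖z‖ < 1 := by simpa using hz
        have hw0 := besovWeight_nonneg n hz
        rw [← ofReal_norm, ← ofReal_norm, ← ENNReal.ofReal_mul hw0, ← ENNReal.ofReal_mul hw0,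
          ← ENNReal.ofReal_mul (by positivity), ← ENNReal.ofReal_add (by positivity) (by positivity)]
        apply ENNReal.ofReal_le_ofReal
        calc _ ≤ besovWeight n z * (2 ^ p * ‖sliceSeries i g z‖ + (2 ^ p * A + A')) := by
              gcongr; exact hpt z hz
          _ = 2 ^ p * (besovWeight n z * ‖sliceSeries i g z‖)
              + besovWeight n z * (2 ^ p * A + A') := by ring
          _ ≤ _ := by
              gcongr
              exact mul_le_of_le_one_left (by positivity) (besovWeight_le_one n hz)
    _ = ENNReal.ofReal (2 ^ p) * sliceNorm n i g
        + ENNReal.ofReal (2 ^ p * A + A') * volume (Metric.ball (0 : ℂ) 1) := by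
        rw [lintegral_add_right _ measurable_const, lintegral_const_mul' _ _ ENNReal.ofReal_ne_top,
          setLIntegral_const, sliceNorm]
    _ < ⊤ := ENNReal.add_lt_top.2 ⟨ENNReal.mul_lt_top ENNReal.ofReal_lt_top h,
        ENNReal.mul_lt_top ENNReal.ofReal_lt_top measure_ball_lt_top⟩

theorem integrableOn_besovWeight_mul (hi : i ∈ imagSphere) {d : ℕ → ℍ[ℝ]} (hd : HasRadiusOne d)
    {n : ℕ} (h : sliceNorm n i d < ⊤) {Ψ : ℂ → ℂ} (hΨ : Measurable Ψ) {M : ℝ}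
    (hM : ∀ z, ‖z‖ < 1 → ‖Ψ z‖ ≤ M) :
    IntegrableOn (fun z => sliceMap i (besovWeight n z * Ψ z) * sliceSeries i d z)
      (Metric.ball 0 1) := by
  have hM0 : 0 ≤ M := (norm_nonneg _).trans (hM 0 (by simp))
  refine ⟨?_, ?_⟩
  · refine AEStronglyMeasurable.mul ?_ (hd.aestronglyMeasurable_sliceSeries hi)
    exact (stronglyMeasurable_sliceMap_comp i ((Complex.measurable_ofReal.comp
      (continuous_besovWeight n).measurable).mul hΨ)).aestronglyMeasurable
  · refine lt_of_le_of_lt (b := ENNReal.ofReal M * sliceNorm n i d) ?_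
      (ENNReal.mul_lt_top ENNReal.ofReal_lt_top h)
    rw [sliceNorm, ← lintegral_const_mul' _ _ ENNReal.ofReal_ne_top]
    refine setLIntegral_mono' measurableSet_ball fun z hz => ?_
    have hz : ‖z‖ < 1 := by simpa using hz
    have hw0 := besovWeight_nonneg n hz
    rw [← ofReal_norm, ← ofReal_norm, ← ENNReal.ofReal_mul hw0, ← ENNReal.ofReal_mul hM0]
    apply ENNReal.ofReal_le_ofReal
    rw [norm_mul, norm_sliceMap hi, norm_mul, Complex.norm_real, Real.norm_of_nonneg hw0]
    calc besovWeight n z * ‖Ψ z‖ * ‖sliceSeries i d z‖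
        ≤ besovWeight n z * M * ‖sliceSeries i d z‖ := by gcongr; exact hM z hz
      _ = _ := by ring

/-- The phases cancel since `m - 1 = (2n - 2) + (m - (2n - 1))`. The unimodular factor lowers the
modulus from `|z|²⁽ᵐ⁻¹⁾` to `|z|²⁽ᵐ⁻ⁿ⁾`, the power whose Beta integral is `(m - n)! (n - 1)! / m!`
up to `π`. -/
theorem moebCoeff_mul_unimodular_mul_pow {n m : ℕ} (hn : 1 < n) (hm : 2 * n - 1 ≤ m) (z : ℂ) :
    moebCoeff z m * (besovWeight n z * unimodular (2 * n - 2) z) * z ^ (m - (2 * n - 1))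
      = ((-(Real.pi)⁻¹ * (‖z‖ ^ (2 * (m - n)) * (1 - ‖z‖ ^ 2) ^ (n - 1)) : ℝ) : ℂ) := by
  obtain ⟨p, rfl⟩ : ∃ p, n = p + 2 := ⟨n - 2, by omega⟩
  obtain ⟨s, rfl⟩ : ∃ s, m = (s + (2 * p + 2)) + 1 := ⟨m - (2 * p + 3), by omega⟩
  rw [show 2 * (p + 2) - 2 = 2 * p + 2 by omega,
    show s + (2 * p + 2) + 1 - (2 * (p + 2) - 1) = s by omega,
    show s + (2 * p + 2) + 1 - (p + 2) = s + p + 1 by omega, moebCoeff, unimodular, besovWeight]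
  have h1 : (starRingEnd ℂ z) ^ (s + (2 * p + 2)) * (z / ‖z‖) ^ (2 * p + 2) * z ^ s
      = ((‖z‖ ^ (2 * (s + p + 1)) : ℝ) : ℂ) := by
    calc _ = (starRingEnd ℂ z * (z / ‖z‖)) ^ (2 * p + 2) * (z * starRingEnd ℂ z) ^ s := by
          rw [mul_pow, mul_pow, pow_add]; ring
      _ = _ := by
          rw [conj_mul_div_norm, Complex.mul_conj, Complex.normSq_eq_norm_sq]
          push_cast
          rw [← pow_mul, ← pow_add]
          congr 1
          ring
  have h2 : ((-(Real.pi)⁻¹ * (‖z‖ ^ (2 * (s + p + 1)) * (1 - ‖z‖ ^ 2) ^ (p + 2 - 1)) : ℝ) : ℂ)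
      = ((‖z‖ ^ (2 * (s + p + 1)) : ℝ) : ℂ) *
        ((-(Real.pi)⁻¹ * (1 - ‖z‖ ^ 2) ^ (p + 1) : ℝ) : ℂ) := by
    rw [← Complex.ofReal_mul]; congr 1; rw [show p + 2 - 1 = p + 1 by omega]; ring
  rw [h2, ← h1, show p + 2 - 2 = p by omega]
  push_cast
  ring

/-- The Beta factor `(m - n)! / m!` is the inverse of the factor by which `n` differentiations
multiply `cₘ`. So one constant `κ` works for all `m ≥ 2n - 1`, and only the finitely many smaller
indices need a correction `g₁`. -/
theorem exists_integral_moebCoeff_eq (hi : i ∈ imagSphere) {n : ℕ} (hn : 1 < n) {c : ℕ → ℍ[ℝ]}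
    (hc : HasRadiusOne c) (h : sliceNorm n i (derivCoeff n c) < ⊤) :
    ∃ g : ℂ → ℍ[ℝ], IntegrableOn g (Metric.ball 0 1) ∧
      ∀ m, ∫ z in Metric.ball (0 : ℂ) 1, sliceMap i (moebCoeff z m) * g z = c m := by
  set N := 2 * n - 1 with hN
  obtain ⟨g₁, hg₁, -, hg₁c⟩ := exists_integral_moebCoeff_eq_of_summable hi
    (c := fun m => if m < N then c m else 0)
    (summable_of_ne_finset_zero (s := Finset.range N) fun m hm => by
      rw [if_neg (by simpa using hm), norm_zero, mul_zero])
  -- With this shift the selected index `m - N` of `d` is the index `m - n` of the `n`-th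
  -- derivative, a multiple of `cₘ`.
  set d : ℕ → ℍ[ℝ] := fun k => derivCoeff n c (k + (n - 1)) with hd
  have hdr : HasRadiusOne d := (hc.derivCoeff n).shift 0 (n - 1) (by simp [hd])
  have hdn : sliceNorm n i d < ⊤ := sliceNorm_shift_lt_top hi (hc.derivCoeff n) n (n - 1) h
  set κ : ℝ := -((n - 1).factorial : ℝ)⁻¹ with hκ
  set G : ℂ → ℍ[ℝ] := fun z =>
    sliceMap i (besovWeight n z * unimodular (2 * n - 2) z) * sliceSeries i d z with hG
  have hGint : IntegrableOn G (Metric.ball 0 1) :=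
    integrableOn_besovWeight_mul hi hdr hdn (measurable_unimodular _)
      fun z _ => norm_unimodular_le _ z
  have hmul : ∀ m, ∀ z, sliceMap i (moebCoeff z m) * G z
      = sliceMap i (moebCoeff z m * (besovWeight n z * unimodular (2 * n - 2) z))
        * sliceSeries i d z := by
    intro m z
    rw [hG, sliceMap_mul hi, mul_assoc]
  have hτint : ∀ (m : ℕ) {u : ℂ → ℍ[ℝ]}, IntegrableOn u (Metric.ball 0 1) →
      IntegrableOn (fun z => sliceMap i (moebCoeff z m) * u z) (Metric.ball 0 1) := by
    intro m u hu
    refine Integrable.bdd_mul (c := 1) hu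
      ((continuous_sliceMap i).comp (continuous_moebCoeff m)).aestronglyMeasurable
      (ae_restrict_of_forall_mem measurableSet_ball fun z hz => ?_)
    rw [norm_sliceMap hi]
    exact norm_moebCoeff_le (by simpa using hz) m
  have hGc : ∀ m, ∫ z in Metric.ball (0 : ℂ) 1, sliceMap i (moebCoeff z m) * G z
      = if N ≤ m then κ⁻¹ • c m else 0 := by
    intro m
    have hhom : RotHomogeneous m N fun z =>
        moebCoeff z m * (besovWeight n z * unimodular (2 * n - 2) z) := by
      have := (rotHomogeneous_moebCoeff m).mul
        ((rotHomogeneous_besovWeight n).mul (rotHomogeneous_unimodular (2 * n - 2)))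
      rwa [show m + (0 + 0) = m by ring, show 1 + (0 + (2 * n - 2)) = N by omega] at this
    simp_rw [hmul]
    rw [hhom.setIntegral_mul_sliceSeries hi hdr
      ((continuous_moebCoeff m).measurable.mul ((Complex.measurable_ofReal.comp
        (continuous_besovWeight n).measurable).mul (measurable_unimodular _))) (M := 1)
      (fun z hz => ?_) (by simpa only [hmul] using hτint m hGint)]
    · refine if_ctx_congr Iff.rfl (fun hm => ?_) fun _ => rfl
      have e := moebCoeff_mul_unimodular_mul_pow hn hm
      rw [← hN] at e
      simp_rw [e]
      rw [integral_complex_ofReal, integral_const_mul, setIntegral_ball_norm_pow_mul,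
        sliceMap_ofReal, Quaternion.coe_mul_eq_smul, hd]
      simp only [derivCoeff]
      rw [show m - N + (n - 1) + n = m by omega, smul_smul]
      congr 1
      rw [show m - n + (n - 1) + 1 = m by omega, hκ,
        ← Nat.factorial_mul_descFactorial (show n ≤ m by omega)]
      have := Real.pi_pos.ne'
      have h1 : ((m - n).factorial : ℝ) ≠ 0 := by positivity
      have h2 : (m.descFactorial n : ℝ) ≠ 0 := by
        have : 0 < m.descFactorial n := Nat.descFactorial_pos.2 (by omega)
        positivity
      push_cast
      field_simp
    · rw [norm_mul, norm_mul, Complex.norm_real, Real.norm_of_nonneg (besovWeight_nonneg n hz)]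
      exact mul_le_one₀ (norm_moebCoeff_le hz m) (by have := besovWeight_nonneg n hz; positivity)
        (mul_le_one₀ (besovWeight_le_one n hz) (norm_nonneg _) (norm_unimodular_le _ z))
  have hκ0 : κ ≠ 0 := by rw [hκ]; exact neg_ne_zero.2 (by positivity)
  refine ⟨fun z => g₁ z + κ • G z, hg₁.add (hGint.smul κ), fun m => ?_⟩
  have hsmul : IntegrableOn (fun z => κ • (sliceMap i (moebCoeff z m) * G z))
    (Metric.ball 0 1) := (hτint m hGint).smul κ
  simp_rw [mul_add, mul_smul_comm]
  rw [integral_add (hτint m hg₁) hsmul, integral_smul, hg₁c, hGc]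
  split_ifs with h1 h2 h2
  · omega
  · simp
  · rw [zero_add, smul_smul, mul_inv_cancel₀ hκ0, one_smul]
  · omega

end Reproducing

/-! ### Integrals of Möbius transformations, and the representing measure -/

section MoebiusIntegral

variable {i j : ℍ[ℝ]}

theorem integrable_moebCoeff_mul (hi : i ∈ imagSphere) {X : Type*} [MeasurableSpace X]
    {ν : Measure X} {α : X → ℂ} (hα : Measurable α) (hα1 : ∀ᵐ x ∂ν, ‖α x‖ < 1) {u : X → ℍ[ℝ]}
    (hu : Integrable u ν) (m : ℕ) :
    Integrable (fun x => sliceMap i (moebCoeff (α x) m) * u x) ν := by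
  refine hu.bdd_mul (c := 1) (stronglyMeasurable_sliceMap_comp i
    ((continuous_moebCoeff m).measurable.comp hα)).aestronglyMeasurable ?_
  filter_upwards [hα1] with x hx
  rw [norm_sliceMap hi]
  exact norm_moebCoeff_le hx m

theorem norm_integral_moebCoeff_mul_le (hi : i ∈ imagSphere) {X : Type*} [MeasurableSpace X]
    {ν : Measure X} {α : X → ℂ} (hα1 : ∀ᵐ x ∂ν, ‖α x‖ < 1) {u : X → ℍ[ℝ]}
    (hu : Integrable u ν) (m : ℕ) :
    ‖∫ x, sliceMap i (moebCoeff (α x) m) * u x ∂ν‖ ≤ ∫ x, ‖u x‖ ∂ν := by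
  refine norm_integral_le_of_norm_le hu.norm ?_
  filter_upwards [hα1] with x hx
  rw [norm_mul, norm_sliceMap hi]
  exact mul_le_of_le_one_left (norm_nonneg _) (norm_moebCoeff_le hx m)

/-- Exchanges the Taylor series with the integral; used for area measure in (iii) and for counting
measure in (ii). The slices of `a` and of `q` may differ. -/
theorem integral_moebius_mul (hi : i ∈ imagSphere) (hj : j ∈ imagSphere) {X : Type*}
    [MeasurableSpace X] {ν : Measure X} {α : X → ℂ} (hα : Measurable α)
    (hα1 : ∀ᵐ x ∂ν, ‖α x‖ < 1) {u : X → ℍ[ℝ]} (hu : Integrable u ν) {z : ℂ} (hz : ‖z‖ < 1) :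
    ∫ x, moebius (sliceMap i (α x)) (sliceMap j z) * u x ∂ν
      = sliceSeries j (fun m => ∫ x, sliceMap i (moebCoeff (α x) m) * u x ∂ν) z := by
  have hint := fun m => integrable_moebCoeff_mul hi hα hα1 hu m
  have hs := hasSum_integral_of_summable_integral_norm (μ := ν)
    (F := fun m x => sliceMap j (z ^ m) * (sliceMap i (moebCoeff (α x) m) * u x))
    (fun m => (hint m).const_mul _) ?_
  · have e1 : ∀ m, ∫ x, sliceMap j (z ^ m) * (sliceMap i (moebCoeff (α x) m) * u x) ∂ν
        = sliceMap j (z ^ m) * ∫ x, sliceMap i (moebCoeff (α x) m) * u x ∂ν := fun m => by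
      have := (ContinuousLinearMap.mul ℝ ℍ[ℝ] (sliceMap j (z ^ m))).integral_comp_comm (hint m)
      simpa using this
    simp_rw [e1] at hs
    rw [sliceSeries, hs.tsum_eq]
    refine integral_congr_ae ?_
    filter_upwards [hα1] with x hx
    rw [moebius_sliceMap hi hj, sliceSeries, ← ((hasRadiusOne_sliceMap hi
      (hasRadiusOne_moebCoeff hx)).hasSum hj hz).summable.tsum_mul_right]
    simp_rw [mul_assoc]
  · refine Summable.of_nonneg_of_le (fun m => by positivity) (fun m => ?_)
      ((summable_geometric_of_lt_one (norm_nonneg _) hz).mul_right (∫ x, ‖u x‖ ∂ν))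
    simp_rw [norm_sliceMap_pow_mul hj]
    rw [integral_mul_const, mul_comm]
    refine mul_le_mul_of_nonneg_left (integral_mono_ae (hint m).norm hu.norm ?_) (by positivity)
    filter_upwards [hα1] with x hx
    rw [norm_mul, norm_sliceMap hi]
    exact mul_le_of_le_one_left (norm_nonneg _) (norm_moebCoeff_le hx m)

theorem continuous_moebius (hi : i ∈ imagSphere) {q : ℍ[ℝ]} (hq : q ∈ unitBall) :
    Continuous fun x : sliceDisc i => moebius (x : ℍ[ℝ]) q := by
  obtain ⟨α, hα, hα1, hα2⟩ := exists_complex_of_sliceDisc hi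
  have e : (fun x : sliceDisc i => moebius (x : ℍ[ℝ]) q)
      = fun x => ∑' m : ℕ, q ^ m * sliceMap i (moebCoeff (α x) m) := by
    funext x
    rw [← hα2 x, moebius_eq hi]
  rw [e]
  refine continuous_tsum (u := fun m : ℕ => ‖q‖ ^ m) (fun m => continuous_const.mul
    ((continuous_sliceMap i).comp ((continuous_moebCoeff m).comp hα)))
    (summable_geometric_of_lt_one (norm_nonneg _) (mem_unitBall.1 hq)) fun m x => ?_
  rw [norm_mul, norm_pow, norm_sliceMap hi]
  exact mul_le_of_le_one_right (by positivity) (norm_moebCoeff_le (hα1 x) m)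

theorem exists_vectorMeasure_of_integrableOn (hi : i ∈ imagSphere) {g : ℂ → ℍ[ℝ]}
    (hg : IntegrableOn g (Metric.ball 0 1)) {c : ℕ → ℍ[ℝ]}
    (hgc : ∀ m, ∫ z in Metric.ball (0 : ℂ) 1, sliceMap i (moebCoeff z m) * g z = c m)
    {f : ℍ[ℝ] → ℍ[ℝ]}
    (hcf : ∀ j ∈ imagSphere, ∀ z : ℂ, ‖z‖ < 1 → f (sliceMap j z) = sliceSeries j c z) :
    ∃ μ : VectorMeasure (sliceDisc i) ℍ[ℝ], μ.variation Set.univ < ⊤ ∧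
      ∀ q ∈ unitBall, f q = μ.integral (fun z => moebius (z : ℍ[ℝ]) q)
        (ContinuousLinearMap.mul ℝ ℍ[ℝ]) := by
  classical
  -- The value `0` outside the disc only makes the map total: the measure pushed forward lives on
  -- the disc.
  let φ : ℂ → sliceDisc i := fun z => ⟨sliceMap i (if ‖z‖ < 1 then z else 0),
    (mem_sliceDisc hi).2 ⟨_, by split_ifs with h <;> simp [h], rfl⟩⟩
  have hφ : Measurable φ := Measurable.subtype_mk <| (continuous_sliceMap i).measurable.comp
    (Measurable.ite (measurableSet_lt measurable_norm measurable_const) measurable_id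
      measurable_const)
  set ν : VectorMeasure ℂ ℍ[ℝ] := (volume.restrict (Metric.ball (0 : ℂ) 1)).withDensityᵥ g with hν
  have hνfin : ν.variation Set.univ < ⊤ := variation_withDensityᵥ_univ_lt_top hg
  have : IsFiniteMeasure ν.variation := ⟨hνfin⟩
  refine ⟨ν.map φ, ?_, fun q hq => ?_⟩
  · refine (VectorMeasure.variation_map_le _).trans_lt ?_
    rwa [Measure.map_apply hφ MeasurableSet.univ, Set.preimage_univ]
  · obtain ⟨j, hj, z, rfl⟩ := exists_sliceMap_eq q
    have hz : ‖z‖ < 1 := (sliceMap_mem_unitBall hj).1 hq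
    have hcont := continuous_moebius hi hq
    have hbound : ∀ x : sliceDisc i, ‖moebius (x : ℍ[ℝ]) (sliceMap j z)‖ ≤ (1 - ‖z‖)⁻¹ := by
      rintro ⟨x, hx⟩
      obtain ⟨w, hw, rfl⟩ := (mem_sliceDisc hi).1 hx
      exact norm_moebius_sliceMap_le hi hj hw hz
    have hsm : StronglyMeasurable fun w => moebius (φ w : ℍ[ℝ]) (sliceMap j z) :=
      (hcont.measurable.comp hφ).stronglyMeasurable
    rw [VectorMeasure.integral_map hφ hcont.aestronglyMeasurable
      (Integrable.of_bound hsm.aestronglyMeasurable _ (Eventually.of_forall fun w => hbound (φ w))),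
      hν, integral_withDensityᵥ hg hsm fun w => hbound (φ w)]
    have hball : ∀ᵐ w ∂(volume.restrict (Metric.ball (0 : ℂ) 1)), ‖w‖ < 1 :=
      ae_restrict_of_forall_mem measurableSet_ball fun w hw => by simpa using hw
    have key := integral_moebius_mul hi hj (ν := volume.restrict (Metric.ball (0 : ℂ) 1))
      measurable_id hball hg hz
    simp only [id] at key
    simp_rw [hgc] at key
    rw [hcf j hj z hz, ← key]
    refine setIntegral_congr_fun measurableSet_ball fun w hw => ?_
    have hw : ‖w‖ < 1 := by simpa using hw
    simp only [φ, if_pos hw]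

end MoebiusIntegral

/-! ### The atomic decomposition -/

section Atomic

variable {i j : ℍ[ℝ]}

theorem norm_moebCoeff_le_pow {a : ℂ} {r : ℝ} (hr0 : 0 < r) (hr : r < 1) (ha : ‖a‖ ≤ r) (m : ℕ) :
    ‖moebCoeff a m‖ ≤ r⁻¹ * r ^ m := by
  have ha1 : ‖a‖ < 1 := ha.trans_lt hr
  cases m with
  | zero =>
    rw [pow_zero, mul_one]
    exact ha1.le.trans (one_le_inv_iff₀.2 ⟨hr0, hr.le⟩)
  | succ m =>
    rw [norm_moebCoeff_succ, pow_succ' r, inv_mul_cancel_left₀ hr0.ne']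
    exact (mul_le_of_le_one_right (by positivity) (abs_normSq_sub_one_le ha1)).trans
      (pow_le_pow_left₀ (norm_nonneg _) ha m)

theorem summable_weight_mul_pow {r : ℝ} (hr0 : 0 < r) (hr : r < 1) :
    Summable fun m : ℕ => ((m : ℝ) + 1) ^ 3 * (2 * (r⁻¹ * r ^ m)) := by
  have hone : HasRadiusOne fun _ : ℕ => (1 : ℝ) := HasRadiusOne.of_norm_le (M := 1) (by simp)
  have := (hone.summable_pow_mul 3 hr0.le hr).mul_left (2 * r⁻¹)
  refine this.congr fun m => ?_
  simp
  ring

theorem weight_mul_norm_moebCoeff_sub_le {a b : ℂ} {r : ℝ} (hr0 : 0 < r) (hr : r < 1)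
    (ha : ‖a‖ ≤ r) (hb : ‖b‖ ≤ r) (m : ℕ) :
    ((m : ℝ) + 1) ^ 3 * ‖moebCoeff a m - moebCoeff b m‖
      ≤ ((m : ℝ) + 1) ^ 3 * (2 * (r⁻¹ * r ^ m)) := by
  gcongr
  refine (norm_sub_le _ _).trans ?_
  linarith [norm_moebCoeff_le_pow hr0 hr ha m, norm_moebCoeff_le_pow hr0 hr hb m]

theorem exists_radius {a b : ℂ} (ha : ‖a‖ < 1) (hb : ‖b‖ < 1) :
    ∃ r : ℝ, 0 < r ∧ r < 1 ∧ ‖a‖ < r ∧ ‖b‖ < r := by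
  obtain ⟨r, h1, h2⟩ := exists_between (max_lt ha hb)
  exact ⟨r, (norm_nonneg a).trans_lt ((le_max_left _ _).trans_lt h1), h2,
    (le_max_left _ _).trans_lt h1, (le_max_right _ _).trans_lt h1⟩

/-- A weighted `ℓ¹` distance between the coefficients of two Möbius transformations. -/
def moebDist (a b : ℂ) : ℝ := ∑' m : ℕ, ((m : ℝ) + 1) ^ 3 * ‖moebCoeff a m - moebCoeff b m‖

theorem summable_moebDist {a b : ℂ} (ha : ‖a‖ < 1) (hb : ‖b‖ < 1) :
    Summable fun m : ℕ => ((m : ℝ) + 1) ^ 3 * ‖moebCoeff a m - moebCoeff b m‖ := by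
  obtain ⟨r, hr0, hr, har, hbr⟩ := exists_radius ha hb
  exact Summable.of_nonneg_of_le (fun m => by positivity)
    (weight_mul_norm_moebCoeff_sub_le hr0 hr har.le hbr.le) (summable_weight_mul_pow hr0 hr)

/-- Each coefficient is continuous, and for `|a| ≤ r < 1` the coefficients are dominated by a
geometric sequence, which beats the cubic weight. -/
theorem tendsto_moebDist {b : ℂ} (hb : ‖b‖ < 1) : Tendsto (fun a => moebDist a b) (𝓝 b) (𝓝 0) := by
  obtain ⟨r, hr0, hr, hbr, -⟩ := exists_radius hb hb
  have h0 : (0 : ℝ) = ∑' m : ℕ, ((m : ℝ) + 1) ^ 3 * ‖moebCoeff b m - moebCoeff b m‖ := by simp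
  rw [h0]
  refine tendsto_tsum_of_dominated_convergence (summable_weight_mul_pow hr0 hr) (fun m => ?_) ?_
  · exact (((((continuous_moebCoeff m).sub continuous_const).norm).const_mul _).tendsto b)
  · filter_upwards [Metric.isOpen_ball.mem_nhds (mem_ball_zero_iff.2 hbr)] with a ha m
    rw [Real.norm_of_nonneg (by positivity)]
    exact weight_mul_norm_moebCoeff_sub_le hr0 hr (mem_ball_zero_iff.1 ha).le hbr.le m

/-- A countable measurable partition of the disc on the cells of which Möbius transformations are
almost constant. -/
theorem exists_partition {ε : ℝ} (hε : 0 < ε) :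
    ∃ (a : ℕ → ℂ) (κ : ℂ → ℕ), Measurable κ ∧ (∀ k, ‖a k‖ < 1) ∧
      ∀ z, ‖z‖ < 1 → moebDist z (a (κ z)) ≤ ε := by
  classical
  -- Interiors are open, hence measurable, and still neighbourhoods of their centres; the Lindelöf
  -- property leaves countably many.
  set U : ℂ → Set ℂ := fun b => interior {z | moebDist z b < ε} with hU
  have hUb : ∀ b ∈ Metric.ball (0 : ℂ) 1, U b ∈ 𝓝[Metric.ball 0 1] b := by
    intro b hb
    refine mem_nhdsWithin_of_mem_nhds (interior_mem_nhds.2 ?_)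
    exact (tendsto_moebDist (mem_ball_zero_iff.1 hb)).eventually_lt_const hε
  obtain ⟨t, htD, htc, htU⟩ := TopologicalSpace.countable_cover_nhdsWithin hUb
  have htne : t.Nonempty := by
    by_contra h
    rw [Set.not_nonempty_iff_eq_empty] at h
    have : (0 : ℂ) ∈ ⋃ x ∈ t, U x := htU (by simp)
    simp [h] at this
  obtain ⟨a, rfl⟩ := htc.exists_eq_range htne
  -- The cell of a point is the first index whose set contains it; points outside the disc satisfy
  -- the predicate trivially so that the search is total.
  have hp : ∀ z, ∃ k : ℕ, z ∉ Metric.ball (0 : ℂ) 1 ∨ z ∈ U (a k) := by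
    intro z
    by_cases hz : z ∈ Metric.ball (0 : ℂ) 1
    · have := htU hz
      simp only [Set.mem_iUnion, Set.mem_range, exists_prop, exists_exists_eq_and] at this
      obtain ⟨k, hk⟩ := this
      exact ⟨k, Or.inr hk⟩
    · exact ⟨0, Or.inl hz⟩
  refine ⟨a, fun z => Nat.find (hp z), ?_, fun k => mem_ball_zero_iff.1 (htD ⟨k, rfl⟩),
    fun z hz => ?_⟩
  · exact measurable_find hp fun k =>
      (measurableSet_ball.compl).union isOpen_interior.measurableSet
  · have h := (Nat.find_spec (hp z)).resolve_left fun h => h (mem_ball_zero_iff.2 hz)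
    simp only [hU] at h
    have h' := interior_subset h
    exact le_of_lt h'

/-- One step of the iteration: `γ k` is the mass of `g` on the `k`-th cell. The resulting error in
the coefficients has weighted `ℓ¹` norm at most `∫ moebDist · |g|`, hence is again represented by a
function on the disc. -/
theorem exists_atomic_approximation (hi : i ∈ imagSphere) {g : ℂ → ℍ[ℝ]}
    (hg : IntegrableOn g (Metric.ball 0 1)) :
    ∃ (a : ℕ → ℂ) (γ : ℕ → ℍ[ℝ]) (g' : ℂ → ℍ[ℝ]), (∀ k, ‖a k‖ < 1) ∧
      Summable (fun k => ‖γ k‖) ∧ ∑' k, ‖γ k‖ ≤ ∫ z in Metric.ball (0 : ℂ) 1, ‖g z‖ ∧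
      IntegrableOn g' (Metric.ball 0 1) ∧
      ∫ z in Metric.ball (0 : ℂ) 1, ‖g' z‖ ≤ (∫ z in Metric.ball (0 : ℂ) 1, ‖g z‖) / 2 ∧
      ∀ m, ∫ z in Metric.ball (0 : ℂ) 1, sliceMap i (moebCoeff z m) * g z
        = ∑' k, sliceMap i (moebCoeff (a k) m) * γ k
          + ∫ z in Metric.ball (0 : ℂ) 1, sliceMap i (moebCoeff z m) * g' z := by
  set D := Metric.ball (0 : ℂ) 1 with hD
  set v : ℝ := volume.real D with hv
  have hv0 : 0 < v := by
    rw [hv, Measure.real]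
    exact ENNReal.toReal_pos (Metric.measure_ball_pos volume 0 one_pos).ne'
      measure_ball_lt_top.ne
  -- With area `v`, the error function is bounded by `‖g‖₁ / (2v)`, so its `L¹` norm is at most
  -- `‖g‖₁ / 2`.
  obtain ⟨a, κ, hκ, ha, haε⟩ := exists_partition (ε := 1 / (2 * v)) (by positivity)
  have hDm : MeasurableSet D := measurableSet_ball
  have hball : ∀ᵐ w ∂(volume.restrict D), ‖w‖ < 1 :=
    ae_restrict_of_forall_mem hDm fun w hw => mem_ball_zero_iff.1 hw
  set E : ℕ → Set ℂ := fun k => D ∩ κ ⁻¹' {k} with hE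
  have hEm : ∀ k, MeasurableSet (E k) := fun k => hDm.inter (hκ (measurableSet_singleton k))
  have hEd : Pairwise (Function.onFun Disjoint E) := by
    intro k l hkl
    refine Set.disjoint_left.2 fun z hz hz' => hkl ?_
    exact (hz.2 : κ z = k).symm.trans hz'.2
  have hEu : ⋃ k, E k = D := by
    ext z
    simp [hE]
  set A : ℝ := ∫ z in D, ‖g z‖ with hA
  have hA0 : 0 ≤ A := integral_nonneg fun _ => norm_nonneg _
  set γ : ℕ → ℍ[ℝ] := fun k => ∫ z in E k, g z with hγ
  have hnorm : HasSum (fun k => ∫ z in E k, ‖g z‖) A := by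
    have := hasSum_integral_iUnion (μ := volume) (f := fun z => ‖g z‖) hEm hEd
      (by rw [hEu]; exact hg.norm)
    rwa [hEu] at this
  have hγle : ∀ k, ‖γ k‖ ≤ ∫ z in E k, ‖g z‖ := fun k => norm_integral_le_integral_norm _
  have hγs : Summable fun k => ‖γ k‖ :=
    Summable.of_nonneg_of_le (fun _ => norm_nonneg _) hγle hnorm.summable
  have hκm : Measurable fun z => a (κ z) := measurable_from_nat.comp hκ
  have hi1 := fun m => integrable_moebCoeff_mul hi measurable_id hball hg m
  have hi2 := fun m => integrable_moebCoeff_mul hi (ν := volume.restrict D) hκm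
    (Eventually.of_forall fun z => ha (κ z)) hg m
  have hsum2 : ∀ m, ∫ z in D, sliceMap i (moebCoeff (a (κ z)) m) * g z
      = ∑' k, sliceMap i (moebCoeff (a k) m) * γ k := by
    intro m
    have := hasSum_integral_iUnion (μ := volume)
      (f := fun z => sliceMap i (moebCoeff (a (κ z)) m) * g z) hEm hEd
      (by rw [hEu]; exact hi2 m)
    rw [hEu] at this
    rw [← this.tsum_eq]
    refine tsum_congr fun k => ?_
    have e : ∫ z in E k, sliceMap i (moebCoeff (a (κ z)) m) * g z
        = ∫ z in E k, sliceMap i (moebCoeff (a k) m) * g z := by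
      refine setIntegral_congr_fun (hEm k) fun z hz => ?_
      have : κ z = k := hz.2
      simp only [this]
    rw [e]
    have hgk : IntegrableOn g (E k) := hg.mono_set Set.inter_subset_left
    have := (ContinuousLinearMap.mul ℝ ℍ[ℝ] (sliceMap i (moebCoeff (a k) m))).integral_comp_comm hgk
    simpa using this
  set e : ℕ → ℍ[ℝ] := fun m => ∫ z in D, sliceMap i (moebCoeff z m - moebCoeff (a (κ z)) m) * g z
    with he
  have hi3 : ∀ m, Integrable (fun z => sliceMap i (moebCoeff z m - moebCoeff (a (κ z)) m) * g z)
      (volume.restrict D) := by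
    intro m
    refine ((hi1 m).sub (hi2 m)).congr (Eventually.of_forall fun z => ?_)
    simp only [Pi.sub_apply, sliceMap_sub, sub_mul, id]
  have hesub : ∀ m, e m = (∫ z in D, sliceMap i (moebCoeff z m) * g z)
      - ∑' k, sliceMap i (moebCoeff (a k) m) * γ k := by
    intro m
    rw [← hsum2, he]
    simp only
    have := integral_sub (hi1 m) (hi2 m)
    simp only [id] at this
    rw [← this]
    simp_rw [sliceMap_sub, sub_mul]
  have hpart : ∀ s : Finset ℕ, ∑ m ∈ s, ((m : ℝ) + 1) ^ 3 * ‖e m‖ ≤ 1 / (2 * v) * A := by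
    intro s
    have hi4 : ∀ m : ℕ, Integrable (fun z => ((m : ℝ) + 1) ^ 3 *
        ‖sliceMap i (moebCoeff z m - moebCoeff (a (κ z)) m) * g z‖) (volume.restrict D) :=
      fun m => (hi3 m).norm.const_mul _
    calc ∑ m ∈ s, ((m : ℝ) + 1) ^ 3 * ‖e m‖
        ≤ ∑ m ∈ s, ∫ z in D, ((m : ℝ) + 1) ^ 3 *
            ‖sliceMap i (moebCoeff z m - moebCoeff (a (κ z)) m) * g z‖ := by
          refine Finset.sum_le_sum fun m _ => ?_
          rw [integral_const_mul]
          gcongr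
          exact norm_integral_le_integral_norm _
      _ = ∫ z in D, ∑ m ∈ s, ((m : ℝ) + 1) ^ 3 *
            ‖sliceMap i (moebCoeff z m - moebCoeff (a (κ z)) m) * g z‖ :=
          (integral_finsetSum _ fun m _ => hi4 m).symm
      _ ≤ ∫ z in D, 1 / (2 * v) * ‖g z‖ := by
          refine setIntegral_mono_on (integrable_finsetSum _ fun m _ => hi4 m)
            (hg.norm.const_mul _) hDm fun z hz => ?_
          have hz : ‖z‖ < 1 := mem_ball_zero_iff.1 hz
          simp_rw [norm_mul, norm_sliceMap hi, ← mul_assoc]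
          rw [← Finset.sum_mul]
          gcongr
          exact ((summable_moebDist hz (ha _)).sum_le_tsum s fun m _ => by positivity).trans
            (haε z hz)
      _ = _ := integral_const_mul _ _
  have hes : Summable fun m : ℕ => ((m : ℝ) + 1) ^ 3 * ‖e m‖ :=
    summable_of_sum_le (fun m => by positivity) hpart
  obtain ⟨g', hg', hg'b, hg'e⟩ := exists_integral_moebCoeff_eq_of_summable hi hes
  refine ⟨a, γ, g', ha, hγs, ?_, hg', ?_, fun m => ?_⟩
  · exact (hγs.tsum_le_tsum hγle hnorm.summable).trans hnorm.tsum_eq.le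
  · have hB : ∑' m : ℕ, ((m : ℝ) + 1) ^ 3 * ‖e m‖ ≤ 1 / (2 * v) * A :=
      hes.tsum_le_of_sum_le hpart
    calc ∫ z in D, ‖g' z‖ ≤ ∫ _ in D, 1 / (2 * v) * A :=
          setIntegral_mono_on hg'.norm (integrable_const _) hDm fun z hz =>
            (hg'b z (mem_ball_zero_iff.1 hz)).trans hB
      _ = A / 2 := by
          rw [setIntegral_const, ← hv, smul_eq_mul]
          field_simp
  · rw [hg'e, hesub]
    abel

/-- Applying the approximation to successive error functions, whose norms are at most `A / 2ˡ`,
gives atoms indexed by `ℕ × ℕ` of total mass at most `2A`; a pairing bijection turns them into one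
sequence. -/
theorem exists_atomic_decomposition (hi : i ∈ imagSphere) {g : ℂ → ℍ[ℝ]}
    (hg : IntegrableOn g (Metric.ball 0 1)) :
    ∃ (a : ℕ → ℂ) (γ : ℕ → ℍ[ℝ]), (∀ k, ‖a k‖ < 1) ∧ Summable (fun k => ‖γ k‖) ∧
      ∀ m, ∫ z in Metric.ball (0 : ℂ) 1, sliceMap i (moebCoeff z m) * g z
        = ∑' k, sliceMap i (moebCoeff (a k) m) * γ k := by
  choose a γ g' ha hγs hγle hg' hg'le heq using
    fun u : {u : ℂ → ℍ[ℝ] // IntegrableOn u (Metric.ball 0 1)} => exists_atomic_approximation hi u.2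
  let u : ℕ → {u : ℂ → ℍ[ℝ] // IntegrableOn u (Metric.ball 0 1)} := fun l =>
    Nat.rec ⟨g, hg⟩ (fun _ w => ⟨g' w, hg' w⟩) l
  have hu : ∀ l, (u (l + 1)).1 = g' (u l) := fun l => rfl
  set A : ℝ := ∫ z in Metric.ball (0 : ℂ) 1, ‖g z‖ with hA
  have hle : ∀ l, ∫ z in Metric.ball (0 : ℂ) 1, ‖(u l).1 z‖ ≤ A * (1 / 2) ^ l := by
    intro l
    induction l with
    | zero => rw [pow_zero, mul_one]; exact le_rfl
    | succ l ih =>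
      rw [hu]
      refine (hg'le (u l)).trans ?_
      rw [pow_succ]
      linarith
  have hgeom : Summable fun l : ℕ => A * (1 / 2 : ℝ) ^ l :=
    (summable_geometric_of_lt_one (by norm_num) (by norm_num)).mul_left A
  have hs : Summable fun p : ℕ × ℕ => ‖γ (u p.1) p.2‖ := by
    rw [summable_prod_of_nonneg fun p => norm_nonneg _]
    exact ⟨fun l => hγs (u l), Summable.of_nonneg_of_le (fun l => tsum_nonneg fun _ => norm_nonneg _)
      (fun l => (hγle (u l)).trans (hle l)) hgeom⟩
  have hdec : ∀ m, HasSum (fun p : ℕ × ℕ => sliceMap i (moebCoeff (a (u p.1) p.2) m) * γ (u p.1) p.2)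
      (∫ z in Metric.ball (0 : ℂ) 1, sliceMap i (moebCoeff z m) * g z) := by
    intro m
    have hsm : Summable fun p : ℕ × ℕ =>
        sliceMap i (moebCoeff (a (u p.1) p.2) m) * γ (u p.1) p.2 := by
      refine Summable.of_norm_bounded hs fun p => ?_
      rw [norm_mul, norm_sliceMap hi]
      exact mul_le_of_le_one_left (norm_nonneg _) (norm_moebCoeff_le (ha _ _) m)
    have h1 := (hsm.hasSum.prod_fiberwise fun l => (hsm.prod_factor l).hasSum).tendsto_sum_nat
    -- The steps telescope: the atoms of the first `L` stages account for everything but the moments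
    -- of the `L`-th error.
    have h2 : ∀ L, ∑ l ∈ Finset.range L, ∑' k, sliceMap i (moebCoeff (a (u l) k) m) * γ (u l) k
        = (∫ z in Metric.ball (0 : ℂ) 1, sliceMap i (moebCoeff z m) * g z)
          - ∫ z in Metric.ball (0 : ℂ) 1, sliceMap i (moebCoeff z m) * (u L).1 z := by
      intro L
      induction L with
      | zero => rw [Finset.sum_range_zero]; exact (sub_self _).symm
      | succ L ih =>
        rw [Finset.sum_range_succ, ih, heq (u L) m, hu]
        abel
    have h3 : Tendsto (fun L => ∫ z in Metric.ball (0 : ℂ) 1, sliceMap i (moebCoeff z m) * (u L).1 z)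
        atTop (𝓝 0) := by
      refine squeeze_zero_norm (fun L => ?_) hgeom.tendsto_atTop_zero
      exact (norm_integral_moebCoeff_mul_le hi (ae_restrict_of_forall_mem measurableSet_ball
        fun w hw => mem_ball_zero_iff.1 hw) (u L).2 m).trans (hle L)
    simp_rw [h2] at h1
    have h4 := tendsto_nhds_unique h1 (h3.const_sub _)
    rw [sub_zero] at h4
    rw [← h4]
    exact hsm.hasSum
  let ψ := Nat.pairEquiv.symm
  refine ⟨fun k => a (u (ψ k).1) (ψ k).2, fun k => γ (u (ψ k).1) (ψ k).2, fun k => ha _ _, ?_,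
    fun m => ?_⟩
  · exact (ψ.summable_iff (f := fun p : ℕ × ℕ => ‖γ (u p.1) p.2‖)).2 hs
  · exact (((ψ.hasSum_iff (f := fun p : ℕ × ℕ =>
      sliceMap i (moebCoeff (a (u p.1) p.2) m) * γ (u p.1) p.2)).2 (hdec m)).tsum_eq).symm

theorem exists_hasSum_moebius_of_integrableOn (hi : i ∈ imagSphere) {g : ℂ → ℍ[ℝ]}
    (hg : IntegrableOn g (Metric.ball 0 1)) {c : ℕ → ℍ[ℝ]}
    (hgc : ∀ m, ∫ z in Metric.ball (0 : ℂ) 1, sliceMap i (moebCoeff z m) * g z = c m)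
    {f : ℍ[ℝ] → ℍ[ℝ]}
    (hcf : ∀ j ∈ imagSphere, ∀ z : ℂ, ‖z‖ < 1 → f (sliceMap j z) = sliceSeries j c z) :
    ∃ γ : ℕ → ℍ[ℝ], Memℓp γ 1 ∧ ∃ a : ℕ → ℍ[ℝ], (∀ k, 1 ≤ k → a k ∈ sliceDisc i) ∧
      ∀ q ∈ unitBall, HasSum (fun k : ℕ => moebius (a (k + 1)) q * γ (k + 1)) (f q - γ 0) := by
  obtain ⟨a, γ, ha, hγ, hdec⟩ := exists_atomic_decomposition hi hg
  -- The constant term can be taken to be `0`; the atoms are shifted to start at index `1`.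
  refine ⟨fun k => Nat.casesOn k 0 γ, ?_, fun k => sliceMap i (a (k - 1)),
    fun k _ => (mem_sliceDisc hi).2 ⟨_, ha _, rfl⟩, fun q hq => ?_⟩
  · refine memℓp_gen ?_
    simp only [ENNReal.toReal_one, Real.rpow_one]
    exact (summable_nat_add_iff 1).1 hγ
  · obtain ⟨j, hj, z, rfl⟩ := exists_sliceMap_eq q
    have hz : ‖z‖ < 1 := (sliceMap_mem_unitBall hj).1 hq
    have hint : Integrable γ (Measure.count : Measure ℕ) := integrable_count_iff.2 hγ
    have hα : ∀ᵐ k ∂(Measure.count : Measure ℕ), ‖a k‖ < 1 := Eventually.of_forall ha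
    have key := integral_moebius_mul hi hj (measurable_from_nat (f := a)) hα hint hz
    have hmi := fun m => integrable_moebCoeff_mul hi (measurable_from_nat (f := a)) hα hint m
    have hbi : Integrable (fun k => moebius (sliceMap i (a k)) (sliceMap j z) * γ k)
        (Measure.count : Measure ℕ) :=
      hint.bdd_mul StronglyMeasurable.of_discrete.aestronglyMeasurable
        (Eventually.of_forall fun k => norm_moebius_sliceMap_le hi hj (ha k) hz)
    have hcm : ∀ m, ∫ k, sliceMap i (moebCoeff (a k) m) * γ k ∂(Measure.count : Measure ℕ)
        = c m := by
      intro m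
      rw [integral_countable (hmi m), ← hgc m, hdec m]
      simp [Measure.real]
    simp_rw [hcm] at key
    rw [integral_countable hbi] at key
    simp only [Measure.real, Measure.count_singleton, ENNReal.toReal_one, one_smul] at key
    have hsum : Summable fun k => moebius (sliceMap i (a k)) (sliceMap j z) * γ k :=
      (integrable_count_iff.1 hbi).of_norm
    simp only [Nat.add_sub_cancel]
    rw [hcf j hj z hz, ← key]
    exact (sub_zero (∑' k, moebius (sliceMap i (a k)) (sliceMap j z) * γ k)).symm ▸ hsum.hasSum

end Atomic

end SliceBesov

end

/-! ### The equivalence -/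

theorem mainTheorem8 (n : ℕ) (hn : 1 < n) (f : ℍ[ℝ] → ℍ[ℝ])
    (hf : SliceBesov.SliceRegularOn f SliceBesov.unitBall)
    (i : ℍ[ℝ]) (hi : i ∈ SliceBesov.imagSphere) :
    List.TFAE [
      SliceBesov.MemBesov 1 n f,
      ∃ γ : ℕ → ℍ[ℝ], Memℓp γ 1 ∧
        ∃ a : ℕ → ℍ[ℝ], (∀ k, 1 ≤ k → a k ∈ SliceBesov.sliceDisc i) ∧
          ∀ q ∈ SliceBesov.unitBall,
            HasSum (fun k : ℕ => SliceBesov.moebius (a (k + 1)) q * γ (k + 1)) (f q - γ 0),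
      ∃ μ : MeasureTheory.VectorMeasure (SliceBesov.sliceDisc i) ℍ[ℝ],
        μ.variation Set.univ < ⊤ ∧
          ∀ q ∈ SliceBesov.unitBall,
            f q = μ.integral (fun z => SliceBesov.moebius (z : ℍ[ℝ]) q)
              (ContinuousLinearMap.mul ℝ ℍ[ℝ])] := by
  obtain ⟨c, hc, hcf⟩ := hf.exists_coeff
  tfae_have 1 → 2 := by
    intro h
    obtain ⟨g, hg, hgc⟩ := SliceBesov.exists_integral_moebCoeff_eq hi hn hc
      ((SliceBesov.memBesov_one_iff hn hc hi hf hcf).1 h)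
    exact SliceBesov.exists_hasSum_moebius_of_integrableOn hi hg hgc hcf
  tfae_have 2 → 1 := by
    rintro ⟨γ, hγ, a, ha, h⟩
    exact SliceBesov.memBesov_one_of_hasSum hn hi hf hγ ha h
  tfae_have 1 → 3 := by
    intro h
    obtain ⟨g, hg, hgc⟩ := SliceBesov.exists_integral_moebCoeff_eq hi hn hc
      ((SliceBesov.memBesov_one_iff hn hc hi hf hcf).1 h)
    exact SliceBesov.exists_vectorMeasure_of_integrableOn hi hg hgc hcf
  tfae_have 3 → 1 := by
    rintro ⟨μ, hμ, h⟩
    exact SliceBesov.memBesov_one_of_eq_integral_sliceDisc hn hi hf hμ h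
  tfae_finish
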